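/- **Setting.** Let $(\mathbb X,\mathcal X)$ be a measurable space with a $\sigma$-finite measure $\mu$, and let $\mathsf N(\mathbb X)$ be the space of $\sigma$-finite counting measures on $\mathbb X$ (that is, $\sigma$-finite measures with values in $\{0,1,2,\dots\}\cup\{\infty\}$), with the smallest $\sigma$-field making all evaluations $\xi\mapsto\xi(B)$, $B\in\mathcal X$, measurable. Let $\eta$ be a Poisson process on $\mathbb X$ with intensity measure $\mu$, defined on a probability space $(\Omega,\mathcal F,\mathbb P)$: a measurable map $\eta:\Omega\to\mathsf N(\mathbb X)$ such that $\eta(B)$ is Poisson distributed with mean $\mu(B)$ for every $B\in\mathcal X$ (if $\mu(B)=\infty$ this means $\eta(B)=\infty$ almost surely), and $\eta(B_1),\dots,\eta(B_n)$ are independent for pairwise disjoint $B_1,\dots,B_n\in\mathcal X$. Assume that $\mathbb P$-almost surely $\delta_x\le\eta$ for $\eta$-a.e. $x$, so that $\eta-\delta_x$ is again a counting measure for $\eta$-a.e. $x$ (this is automatic, for instance, if $\mathbb X$ is a standard Borel space, or if all singletons are measurable and $\eta$ is a countable sum of Dirac measures). Let $F$ be an integrable random variable with $F=f(\eta)$ $\mathbb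 P$-almost surely for some measurable $f:\mathsf N(\mathbb X)\to\mathbb R$, and write $a_+=\max\{0,a\}$, $a_-=\min\{0,a\}$ and $D_xF=f(\eta+\delta_x)-f(\eta)$. Define the $[0,\infty]$-valued quantities $$V^+=\int_{\mathbb X}(D_xF)_-^2\,\mu(\mathrm dx)+\int_{\mathbb X}\big(f(\eta)-f(\eta-\delta_x)\big)_+^2\,\eta(\mathrm dx),$$ $$V^-=\int_{\mathbb X}(D_xF)_+^2\,\mu(\mathrm dx)+\int_{\mathbb X}\big(f(\eta)-f(\eta-\delta_x)\big)_-^2\,\eta(\mathrm dx),$$ $$V=\int_{\mathbb X}(D_xF)^2\,\mu(\mathrm dx)+\int_{\mathbb X}\big(f(\eta)-f(\eta-\delta_x)\big)^2\,\eta(\mathrm dx),$$ and put $\kappa=\dfrac{\sqrt e}{2(\sqrt e-1)}$. **Corollary 4.3 (Concentration bounds).** Let $L>0$. 1. If $V^+\le L$ $\mathbb P$-almost surely, then $\mathbb P(F-\mathbb E[F]\ge t)\le e^{-ct^2/L}$ for every $t\ge 4\sqrt\kappa$, where $c=\log(2)/(8\kappa)$. 2. If $V^-\le L$ $\mathbb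 P$-almost surely, then $\mathbb P(F-\mathbb E[F]\le -t)\le e^{-ct^2/L}$ for every $t\ge 4\sqrt\kappa$, where $c=\log(2)/(8\kappa)$. 3. If $V\le L$ $\mathbb P$-almost surely, then $\mathbb P(|F-\mathbb E[F]|\ge t)\le 2e^{-ct^2/L}$ for every $t\ge 0$, where $c=\log(2)/(16\kappa)$. -/

import Mathlib

open MeasureTheory ProbabilityTheory
open scoped ENNReal NNReal

noncomputable section

namespace PoissonConcentration

/-- The predicate "`ξ` is a `σ`-finite counting measure": `ξ` is `σ`-finite and takes values in
`{0, 1, 2, …} ∪ {∞}` on the measurable sets. -/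
def IsCounting {X : Type*} [MeasurableSpace X] (ξ : Measure X) : Prop :=
  SigmaFinite ξ ∧ ∀ B : Set X, MeasurableSet B → ∃ n : ℕ∞, ξ B = (n : ℝ≥0∞)

/-- The space `N(X)` of `σ`-finite counting measures on `X`. As a subtype of `Measure X` it carries
the smallest `σ`-field that makes the evaluations `ξ ↦ ξ B`, `B` measurable, measurable. -/
abbrev CountingMeasure (X : Type*) [MeasurableSpace X] : Type _ :=
  {ξ : Measure X // IsCounting ξ}

theorem IsCounting.add_dirac {X : Type*} [MeasurableSpace X] {ξ : Measure X}
    (h : IsCounting ξ) (x : X) : IsCounting (ξ + Measure.dirac x) := by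
  obtain ⟨h1, h2⟩ := h
  refine ⟨inferInstance, fun B hB => ?_⟩
  obtain ⟨n, hn⟩ := h2 B hB
  by_cases hx : x ∈ B
  · exact ⟨n + 1, by simp [hn, hB, hx]⟩
  · exact ⟨n, by simp [hn, hB, hx]⟩

theorem IsCounting.sub_dirac {X : Type*} [MeasurableSpace X] {ξ : Measure X}
    (h : IsCounting ξ) {x : X} (hx : Measure.dirac x ≤ ξ) :
    IsCounting (ξ - Measure.dirac x) := by
  obtain ⟨h1, h2⟩ := h
  refine ⟨⟨⟨⟨spanningSets ξ, fun _ => trivial, fun i => ?_, iUnion_spanningSets ξ⟩⟩⟩,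
    fun B hB => ?_⟩
  · exact (Measure.le_iff'.1 Measure.sub_le _).trans_lt (measure_spanningSets_lt_top ξ i)
  · obtain ⟨n, hn⟩ := h2 B hB
    rw [Measure.sub_apply hB hx, hn, Measure.dirac_apply' x hB]
    by_cases hxB : x ∈ B
    · exact ⟨n - 1, by simp [hxB]⟩
    · exact ⟨n, by simp [hxB]⟩

/-- `ξ + δ_x`. -/
def addPoint {X : Type*} [MeasurableSpace X] (ξ : CountingMeasure X) (x : X) :
    CountingMeasure X :=
  ⟨ξ.1 + Measure.dirac x, ξ.2.add_dirac x⟩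

open Classical in
/-- `ξ - δ_x` at those `x` with `δ_x ≤ ξ`, that is, where the difference is again a counting
measure. At the other `x` the difference does not exist, and `ξ` is returned by convention. -/
def removePoint {X : Type*} [MeasurableSpace X] (ξ : CountingMeasure X) (x : X) :
    CountingMeasure X :=
  if h : Measure.dirac x ≤ ξ.1 then
    ⟨ξ.1 - Measure.dirac x, ξ.2.sub_dirac h⟩
  else ξ

/-- The Poisson distribution with mean `m ∈ [0, ∞]`, as a law on `[0, ∞]`; for `m = ∞` it is the
point mass at `∞`. -/
def poissonLaw (m : ℝ≥0∞) : Measure ℝ≥0∞ :=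
  if m = ∞ then Measure.dirac ∞
  else (poissonMeasure m.toNNReal).map (fun n : ℕ => (n : ℝ≥0∞))

/-- `η` is a Poisson process on `X` with intensity measure `μ`, defined on the probability
space `(Ω, P)`. -/
structure IsPoissonProcess {Ω X : Type*} [MeasurableSpace Ω] [MeasurableSpace X]
    (η : Ω → CountingMeasure X) (μ : Measure X) (P : Measure Ω) : Prop where
  measurable : Measurable η
  law : ∀ B : Set X, MeasurableSet B → P.map (fun ω => (η ω).1 B) = poissonLaw (μ B)
  indep : ∀ (n : ℕ) (B : Fin n → Set X), (∀ i, MeasurableSet (B i)) →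
    (Pairwise fun i j => Disjoint (B i) (B j)) → iIndepFun (fun i ω => (η ω).1 (B i)) P

/-- The difference operator `D_x f (ξ) = f (ξ + δ_x) - f (ξ)`. -/
def addDiff {X : Type*} [MeasurableSpace X] (f : CountingMeasure X → ℝ)
    (ξ : CountingMeasure X) (x : X) : ℝ :=
  f (addPoint ξ x) - f ξ

/-- The difference `f (ξ) - f (ξ - δ_x)`. -/
def removeDiff {X : Type*} [MeasurableSpace X] (f : CountingMeasure X → ℝ)
    (ξ : CountingMeasure X) (x : X) : ℝ :=
  f ξ - f (removePoint ξ x)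

/-- `V⁺ = ∫ (D_x F)₋² μ(dx) + ∫ (F(η) - F(η - δ_x))₊² η(dx)`, with values in `[0, ∞]`. -/
def VPlus {X : Type*} [MeasurableSpace X] (μ : Measure X) (f : CountingMeasure X → ℝ)
    (ξ : CountingMeasure X) : ℝ≥0∞ :=
  (∫⁻ x, ENNReal.ofReal ((min 0 (addDiff f ξ x)) ^ 2) ∂μ) +
    ∫⁻ x, ENNReal.ofReal ((max 0 (removeDiff f ξ x)) ^ 2) ∂ξ.1

/-- `V⁻ = ∫ (D_x F)₊² μ(dx) + ∫ (F(η) - F(η - δ_x))₋² η(dx)`, with values in `[0, ∞]`. -/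
def VMinus {X : Type*} [MeasurableSpace X] (μ : Measure X) (f : CountingMeasure X → ℝ)
    (ξ : CountingMeasure X) : ℝ≥0∞ :=
  (∫⁻ x, ENNReal.ofReal ((max 0 (addDiff f ξ x)) ^ 2) ∂μ) +
    ∫⁻ x, ENNReal.ofReal ((min 0 (removeDiff f ξ x)) ^ 2) ∂ξ.1

/-- `V = ∫ (D_x F)² μ(dx) + ∫ (F(η) - F(η - δ_x))² η(dx)`, with values in `[0, ∞]`. -/
def VTotal {X : Type*} [MeasurableSpace X] (μ : Measure X) (f : CountingMeasure X → ℝ)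
    (ξ : CountingMeasure X) : ℝ≥0∞ :=
  (∫⁻ x, ENNReal.ofReal ((addDiff f ξ x) ^ 2) ∂μ) +
    ∫⁻ x, ENNReal.ofReal ((removeDiff f ξ x) ^ 2) ∂ξ.1

/-- The constant `κ = √e / (2 (√e - 1))`. -/
def kappa : ℝ := √(Real.exp 1) / (2 * (√(Real.exp 1) - 1))

end PoissonConcentration

end

noncomputable section

namespace PoissonConcentration

/-! ### Entropy and the symmetrised relative entropy kernel -/

/-! The argument is the entropy method on Poisson space. Write Ent for the entropy of a positive
function and `psi a b = (b - a)(log b - log a)`. Everything rests on the modified logarithmic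
Sobolev inequality `IsPoissonLaw.ent_le`: for G with values in a compact subinterval of (0, ∞),
Ent(G) ≤ E ∫ psi(G(η), G(η + δ_x)) μ(dx).

Apply it to G = exp(lφ) with l > 0 and φ a truncation of f. Since (e^v - e^u)(v - u) ≤ e^v (v - u)²
for u ≤ v, each increment can be charged to its larger endpoint (`psi_exp_le`). A negative increment
is charged to η, a positive one to η + δ_x, and the Mecke equation turns the latter into an integral
against η itself. The total charge is at most l² E[V⁺ e^{lφ}] ≤ l² L E[e^{lφ}]. Herbst's argument
then gives log E exp(l(φ - Eφ)) ≤ l² L, Fatou's lemma removes the truncation, and Chernoff's bound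
gives the upper tail exp(-t²/(4L)). As κ ≥ 1/2, the constants log 2/(8κ) and log 2/(16κ) are at most
1/4, so this implies the stated bounds. The lower tail is the upper tail of -F, and V dominates both
V⁺ and V⁻.

The Sobolev inequality is built up from dimension one. For a Poisson law of small mean r it holds up
to an error O(r²), by looking at the atoms 0 and 1 only (`ent_poissonMeasure_le_add_sq`). It
tensorises (`ent_prod_le`), so infinite divisibility removes the error (`ent_poissonMeasure_le`),
and products of Poisson laws follow. Conditioning G on the counts of finitely many disjoint sets
reduces to such a product; joint convexity of `psi` and the Mecke equation bound the resulting
energy by that of G (`IsPoissonLaw.psi_le_lintegral`). A measurable function depends on countably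
many counts only, so martingale convergence along refining partitions recovers Ent(G). -/

/-- The function `(a, b) ↦ (b - a) (log b - log a)`. -/
def psi (a b : ℝ) : ℝ := (b - a) * (Real.log b - Real.log a)

/-- The entropy `∫ g log g - (∫ g) log (∫ g)`. -/
def ent {A : Type*} [MeasurableSpace A] (α : Measure A) (g : A → ℝ) : ℝ :=
  ∫ x, g x * Real.log (g x) ∂α - (∫ x, g x ∂α) * Real.log (∫ x, g x ∂α)

theorem measurable_psi {A : Type*} [MeasurableSpace A] {u v : A → ℝ} (hu : Measurable u)
    (hv : Measurable v) : Measurable fun x => psi (u x) (v x) :=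
  (hv.sub hu).mul (hv.log.sub hu.log)

theorem psi_nonneg {a b : ℝ} (ha : 0 < a) (hb : 0 < b) : 0 ≤ psi a b := by
  unfold psi
  rcases le_total a b with h | h
  · exact mul_nonneg (by linarith) (by linarith [Real.log_le_log ha h])
  · exact mul_nonneg_of_nonpos_of_nonpos (by linarith) (by linarith [Real.log_le_log hb h])

theorem psi_le {a b u v : ℝ} (ha : 0 < a) (hu : u ∈ Set.Icc a b) (hv : v ∈ Set.Icc a b) :
    psi u v ≤ (b - a) * (Real.log b - Real.log a) := by
  have hu0 := ha.trans_le hu.1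
  have hv0 := ha.trans_le hv.1
  have h1 := Real.log_le_log ha hu.1
  have h2 := Real.log_le_log ha hv.1
  have h3 := Real.log_le_log hu0 hu.2
  have h4 := Real.log_le_log hv0 hv.2
  unfold psi
  rcases le_total u v with h | h
  · have := Real.log_le_log hu0 h
    exact mul_le_mul (by linarith [hu.1, hv.2]) (by linarith) (by linarith)
      (by linarith [hu.1, hv.2])
  · have := Real.log_le_log hv0 h
    have := mul_le_mul (a := u - v) (b := b - a) (c := Real.log u - Real.log v)
      (d := Real.log b - Real.log a) (by linarith [hv.1, hu.2]) (by linarith) (by linarith)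
      (by linarith [hv.1, hu.2])
    linarith

/-- `psi` is convex and homogeneous of degree one, so its tangent plane at (p, q) passes through the
origin and lies below the graph. This linear minorant is what makes Jensen's inequality below a
matter of integrating a pointwise bound. -/
theorem psi_tangent {u v p q : ℝ} (hu : 0 < u) (hv : 0 < v) (hp : 0 < p) (hq : 0 < q) :
    u * (Real.log p - Real.log q + 1 - q / p) + v * (Real.log q - Real.log p + 1 - p / q) ≤
      psi u v := by
  -- `psi u v` is the sum of `v log (v / u)` and `u log (u / v)`; each is bounded below through `log
  -- z ≥ 1 - 1 / z` at `z = t x / (s y)`.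
  have key : ∀ {s t x y : ℝ}, 0 < s → 0 < t → 0 < x → 0 < y →
      t - s * (y / x) ≤ t * (Real.log t - Real.log s + Real.log x - Real.log y) := by
    intro s t x y hs ht hx hy
    have h := Real.one_sub_inv_le_log_of_pos (x := t * x / (s * y)) (by positivity)
    rw [Real.log_div (by positivity) (by positivity), Real.log_mul ht.ne' hx.ne',
      Real.log_mul hs.ne' hy.ne'] at h
    have h2 := mul_le_mul_of_nonneg_left h ht.le
    have h3 : t * (1 - (t * x / (s * y))⁻¹) = t - s * (y / x) := by
      field_simp
    linarith
  have h1 := key hu hv hp hq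
  have h2 := key hv hu hq hp
  unfold psi
  linarith

theorem integrable_of_mem_Icc {A : Type*} [MeasurableSpace A] {ν : Measure A} [IsFiniteMeasure ν]
    {a b : ℝ} {u : A → ℝ} (hu : Measurable u) (hab : ∀ x, u x ∈ Set.Icc a b) : Integrable u ν :=
  Integrable.of_mem_Icc a b hu.aemeasurable (Filter.Eventually.of_forall hab)

theorem integrable_psi {A : Type*} [MeasurableSpace A] {ν : Measure A} [IsFiniteMeasure ν]
    {a b : ℝ} (ha : 0 < a) {u v : A → ℝ} (hu : Measurable u) (hv : Measurable v)
    (hu' : ∀ x, u x ∈ Set.Icc a b) (hv' : ∀ x, v x ∈ Set.Icc a b) :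
    Integrable (fun x => psi (u x) (v x)) ν :=
  integrable_of_mem_Icc (measurable_psi hu hv) fun x =>
    ⟨psi_nonneg (ha.trans_le (hu' x).1) (ha.trans_le (hv' x).1), psi_le ha (hu' x) (hv' x)⟩

theorem psi_jensen {A : Type*} [MeasurableSpace A] {ν : Measure A} [IsFiniteMeasure ν]
    {a b : ℝ} (ha : 0 < a) {u v : A → ℝ} (hu : Measurable u) (hv : Measurable v)
    (hu' : ∀ x, u x ∈ Set.Icc a b) (hv' : ∀ x, v x ∈ Set.Icc a b) {p q : ℝ} (hp : 0 < p)
    (hq : 0 < q) (hpu : ν.real Set.univ * p = ∫ x, u x ∂ν)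
    (hqv : ν.real Set.univ * q = ∫ x, v x ∂ν) :
    ν.real Set.univ * psi p q ≤ ∫ x, psi (u x) (v x) ∂ν := by
  have iu : Integrable u ν := integrable_of_mem_Icc hu hu'
  have iv : Integrable v ν := integrable_of_mem_Icc hv hv'
  calc ν.real Set.univ * psi p q
      = ∫ x, (u x * (Real.log p - Real.log q + 1 - q / p) +
          v x * (Real.log q - Real.log p + 1 - p / q)) ∂ν := by
        rw [integral_add (iu.mul_const _) (iv.mul_const _), integral_mul_const,
          integral_mul_const, ← hpu, ← hqv]
        unfold psi
        field_simp
        ring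
    _ ≤ _ := integral_mono ((iu.mul_const _).add (iv.mul_const _))
        (integrable_psi ha hu hv hu' hv')
        fun x => psi_tangent (ha.trans_le (hu' x).1) (ha.trans_le (hv' x).1) hp hq

theorem mul_log_mem_Icc {a b x : ℝ} (ha : 0 < a) (hx : x ∈ Set.Icc a b) :
    x * Real.log x ∈ Set.Icc (-(b * (|Real.log a| + |Real.log b|)))
      (b * (|Real.log a| + |Real.log b|)) := by
  have hx0 := ha.trans_le hx.1
  have h1 := Real.log_le_log ha hx.1
  have h2 := Real.log_le_log hx0 hx.2
  have h3 : |Real.log x| ≤ |Real.log a| + |Real.log b| :=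
    abs_le.2 ⟨by linarith [neg_abs_le (Real.log a), abs_nonneg (Real.log b)],
      by linarith [le_abs_self (Real.log b), abs_nonneg (Real.log a)]⟩
  rw [Set.mem_Icc, ← abs_le, abs_mul, abs_of_pos hx0]
  exact mul_le_mul hx.2 h3 (abs_nonneg _) (hx0.le.trans hx.2)

theorem integrable_mul_log {A : Type*} [MeasurableSpace A] {ν : Measure A} [IsFiniteMeasure ν]
    {a b : ℝ} (ha : 0 < a) {u : A → ℝ} (hu : Measurable u) (hu' : ∀ x, u x ∈ Set.Icc a b) :
    Integrable (fun x => u x * Real.log (u x)) ν :=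
  integrable_of_mem_Icc (hu.mul hu.log) fun x => mul_log_mem_Icc ha (hu' x)

theorem integral_mem_Icc {A : Type*} [MeasurableSpace A] {ν : Measure A} [IsProbabilityMeasure ν]
    {a b : ℝ} {u : A → ℝ} (hu : Measurable u) (hu' : ∀ x, u x ∈ Set.Icc a b) :
    ∫ x, u x ∂ν ∈ Set.Icc a b := by
  have iu : Integrable u ν := integrable_of_mem_Icc hu hu'
  constructor
  · simpa using integral_mono (integrable_const a) iu fun x => (hu' x).1
  · simpa using integral_mono iu (integrable_const b) fun x => (hu' x).2

/-- The entropy is at most the mean of `psi c`, for every constant `c`. -/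
theorem ent_le_integral_psi {A : Type*} [MeasurableSpace A] {ν : Measure A}
    [IsProbabilityMeasure ν] {a b : ℝ} (ha : 0 < a) {g : A → ℝ} (hg : Measurable g)
    (hg' : ∀ x, g x ∈ Set.Icc a b) {c : ℝ} (hc : c ∈ Set.Icc a b) :
    ent ν g ≤ ∫ x, psi c (g x) ∂ν := by
  have hc0 := ha.trans_le hc.1
  have ig : Integrable g ν := integrable_of_mem_Icc hg hg'
  have il : Integrable (fun x => g x * Real.log (g x)) ν := integrable_mul_log ha hg hg'
  -- Nonnegativity of the Bregman divergence of `t log t`. It is used twice: at the mean of `g`, to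
  -- replace the mean by `c` in the entropy, and at the pair `(g x, c)`, to add the missing half of
  -- `psi c (g x)`.
  have aux : ∀ {s t : ℝ}, 0 < s → 0 < t → t * Real.log s + t - s ≤ t * Real.log t := by
    intro s t hs ht
    have h := Real.one_sub_inv_le_log_of_pos (x := t / s) (by positivity)
    rw [Real.log_div ht.ne' hs.ne'] at h
    have h2 := mul_le_mul_of_nonneg_left h ht.le
    have h3 : t * (1 - (t / s)⁻¹) = t - s := by field_simp
    linarith
  have hm := ha.trans_le (integral_mem_Icc (ν := ν) hg hg').1
  have h1 := aux hc0 hm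
  have ic : Integrable (fun x => g x * (Real.log c + 1) - c) ν :=
    (ig.mul_const _).sub (integrable_const _)
  have h2 : ∫ x, (g x * Real.log (g x) - (g x * (Real.log c + 1) - c)) ∂ν ≤
      ∫ x, psi c (g x) ∂ν := by
    refine integral_mono (il.sub ic)
      (integrable_psi ha measurable_const hg (fun _ => hc) hg') fun x => ?_
    have := aux (ha.trans_le (hg' x).1) hc0
    simp only [psi]
    linarith
  rw [integral_sub il ic,
    integral_sub (ig.mul_const _) (integrable_const _), integral_mul_const] at h2
  simp only [integral_const, probReal_univ, one_smul] at h2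
  unfold ent
  linarith

/-- Chain rule for the entropy on a product space. -/
theorem ent_prod {A B : Type*} [MeasurableSpace A] [MeasurableSpace B] {α : Measure A}
    {β : Measure B} [IsProbabilityMeasure α] [IsProbabilityMeasure β] {a b : ℝ} (ha : 0 < a)
    {G : A × B → ℝ} (hG : Measurable G) (hG' : ∀ z, G z ∈ Set.Icc a b) :
    ent (α.prod β) G = ∫ x, ent β (fun y => G (x, y)) ∂α + ent α fun x => ∫ y, G (x, y) ∂β := by
  have hm : Measurable fun x => ∫ y, G (x, y) ∂β :=
    hG.stronglyMeasurable.integral_prod_right'.measurable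
  have hm' : ∀ x, ∫ y, G (x, y) ∂β ∈ Set.Icc a b := fun x =>
    integral_mem_Icc (hG.comp measurable_prodMk_left) fun y => hG' (x, y)
  have il : Integrable (fun z => G z * Real.log (G z)) (α.prod β) := integrable_mul_log ha hG hG'
  unfold ent
  rw [integral_prod _ il, integral_prod _ (integrable_of_mem_Icc hG hG'),
    integral_sub il.integral_prod_left (integrable_mul_log ha hm hm')]
  ring

/-- Tensorisation of modified logarithmic Sobolev inequalities. -/
theorem ent_prod_le {A B : Type*} [MeasurableSpace A] [MeasurableSpace B] {α : Measure A}
    {β : Measure B} [IsProbabilityMeasure α] [IsProbabilityMeasure β] {a b : ℝ} (ha : 0 < a)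
    {I J : Type*} [Fintype I] [Fintype J] {S : I → A → A} {T : J → B → B}
    (hS : ∀ i, Measurable (S i)) (hT : ∀ j, Measurable (T j)) {r : I → ℝ≥0} {s : J → ℝ≥0}
    {d e : ℝ}
    (hα : ∀ g : A → ℝ, Measurable g → (∀ x, g x ∈ Set.Icc a b) →
      ent α g ≤ ∑ i, r i * ∫ x, psi (g x) (g (S i x)) ∂α + d)
    (hβ : ∀ g : B → ℝ, Measurable g → (∀ x, g x ∈ Set.Icc a b) →
      ent β g ≤ ∑ j, s j * ∫ x, psi (g x) (g (T j x)) ∂β + e)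
    {G : A × B → ℝ} (hG : Measurable G) (hG' : ∀ z, G z ∈ Set.Icc a b) :
    ent (α.prod β) G ≤ ∑ i, r i * ∫ z, psi (G z) (G (S i z.1, z.2)) ∂(α.prod β) +
      ∑ j, s j * ∫ z, psi (G z) (G (z.1, T j z.2)) ∂(α.prod β) + (d + e) := by
  have hm : Measurable fun x => ∫ y, G (x, y) ∂β :=
    hG.stronglyMeasurable.integral_prod_right'.measurable
  have hm' : ∀ x, ∫ y, G (x, y) ∂β ∈ Set.Icc a b := fun x =>
    integral_mem_Icc (hG.comp measurable_prodMk_left) fun y => hG' (x, y)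
  have hGx : ∀ x, Measurable fun y => G (x, y) := fun x => hG.comp measurable_prodMk_left
  have hGS : ∀ i, Measurable fun z : A × B => G (S i z.1, z.2) := fun i =>
    hG.comp (((hS i).comp measurable_fst).prodMk measurable_snd)
  have hGT : ∀ j, Measurable fun z : A × B => G (z.1, T j z.2) := fun j =>
    hG.comp (measurable_fst.prodMk ((hT j).comp measurable_snd))
  have iS : ∀ i, Integrable (fun z : A × B => psi (G z) (G (S i z.1, z.2))) (α.prod β) := fun i =>
    integrable_psi ha hG (hGS i) hG' fun _ => hG' _
  have iT : ∀ j, Integrable (fun z : A × B => psi (G z) (G (z.1, T j z.2))) (α.prod β) := fun j =>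
    integrable_psi ha hG (hGT j) hG' fun _ => hG' _
  have il : Integrable (fun z => G z * Real.log (G z)) (α.prod β) := integrable_mul_log ha hG hG'
  have h1 : ∫ x, ent β (fun y => G (x, y)) ∂α ≤
      ∑ j, s j * ∫ z, psi (G z) (G (z.1, T j z.2)) ∂(α.prod β) + e := by
    have hI : Integrable (fun x => ∑ j, s j * ∫ y, psi (G (x, y)) (G (x, T j y)) ∂β) α :=
      integrable_finsetSum _ fun j _ => ((iT j).integral_prod_left).const_mul _
    calc ∫ x, ent β (fun y => G (x, y)) ∂α
        ≤ ∫ x, (∑ j, s j * ∫ y, psi (G (x, y)) (G (x, T j y)) ∂β + e) ∂α := by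
          refine integral_mono (il.integral_prod_left.sub (integrable_mul_log ha hm hm'))
            (hI.add (integrable_const _)) fun x => hβ _ (hGx x) fun y => hG' _
      _ = _ := by
          rw [integral_add hI (integrable_const _), integral_finsetSum _ fun j _ =>
            ((iT j).integral_prod_left).const_mul _]
          simp only [integral_const_mul, integral_const, probReal_univ, one_smul]
          congr 1
          exact Finset.sum_congr rfl fun j _ => by rw [integral_prod _ (iT j)]
  have h2 : (ent α fun x => ∫ y, G (x, y) ∂β) ≤
      ∑ i, r i * ∫ z, psi (G z) (G (S i z.1, z.2)) ∂(α.prod β) + d := by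
    refine (hα _ hm hm').trans (add_le_add_left (Finset.sum_le_sum fun i _ =>
      mul_le_mul_of_nonneg_left ?_ (r i).2) _)
    rw [integral_prod _ (iS i)]
    refine integral_mono (integrable_psi ha hm (hm.comp (hS i)) hm' fun x => hm' _)
      (iS i).integral_prod_left fun x => ?_
    -- The inequality for `α` is applied to the partial mean of `G`; joint convexity moves the
    -- `β`-integral outside `psi`.
    have := psi_jensen (ν := β) ha (hGx x) (hGx (S i x)) (fun y => hG' _) (fun y => hG' _)
      (ha.trans_le (hm' x).1) (ha.trans_le (hm' (S i x)).1) (by simp) (by simp)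
    simpa using this
  rw [ent_prod ha hG hG']
  linarith

/-! ### The modified logarithmic Sobolev inequality for products of Poisson laws -/

/-- Compare the entropy with the mean of `psi (g 0) (g k)`. The atom 0 contributes nothing. The atom
1 has mass r times that of 0, so its contribution is bounded by r times the energy. All further
atoms have total mass at most r², and `psi` is bounded there by C. -/
theorem ent_poissonMeasure_le_add_sq {a b : ℝ} (ha : 0 < a) (r : ℝ≥0) {g : ℕ → ℝ}
    (hg : ∀ x, g x ∈ Set.Icc a b) :
    ent (poissonMeasure r) g ≤ r * ∫ k, psi (g k) (g (k + 1)) ∂(poissonMeasure r) +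
      (b - a) * (Real.log b - Real.log a) * r ^ 2 := by
  set C := (b - a) * (Real.log b - Real.log a)
  set π := poissonMeasure r
  have h01 : 0 ≤ psi (g 0) (g 1) :=
    psi_nonneg (ha.trans_le (hg 0).1) (ha.trans_le (hg 1).1)
  have hC : 0 ≤ C := h01.trans (psi_le ha (hg 0) (hg 1))
  have p0 : π.real {0} = Real.exp (-r) := by simp [π, poissonMeasure_real_singleton]
  have p1 : π.real {1} = Real.exp (-r) * r := by simp [π, poissonMeasure_real_singleton]
  have hi0 : Integrable (({0} : Set ℕ).indicator fun _ => (1 : ℝ)) π :=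
    (integrable_const 1).indicator (by simp)
  have hi1 : Integrable (({1} : Set ℕ).indicator fun _ => (1 : ℝ)) π :=
    (integrable_const 1).indicator (by simp)
  have e0 : ∫ k, ({0} : Set ℕ).indicator (fun _ => (1 : ℝ)) k ∂π = π.real {0} := by
    rw [integral_indicator_const _ (by simp)]; simp
  have e1 : ∫ k, ({1} : Set ℕ).indicator (fun _ => (1 : ℝ)) k ∂π = π.real {1} := by
    rw [integral_indicator_const _ (by simp)]; simp
  have i0 : Integrable (fun k => 1 - ({0} : Set ℕ).indicator (fun _ => (1 : ℝ)) k) π :=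
    (integrable_const 1).sub hi0
  have i01 : Integrable (fun k => 1 - ({0} : Set ℕ).indicator (fun _ => (1 : ℝ)) k -
      ({1} : Set ℕ).indicator (fun _ => (1 : ℝ)) k) π := i0.sub hi1
  have h1 : ent π g ≤ π.real {1} * psi (g 0) (g 1) + C * (1 - π.real {0} - π.real {1}) := by
    refine (ent_le_integral_psi ha .of_discrete hg (hg 0)).trans ?_
    have : ∫ k, ((({1} : Set ℕ).indicator (fun _ => (1 : ℝ)) k) * psi (g 0) (g 1) +
        C * (1 - ({0} : Set ℕ).indicator (fun _ => (1 : ℝ)) k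
          - ({1} : Set ℕ).indicator (fun _ => (1 : ℝ)) k)) ∂π =
        π.real {1} * psi (g 0) (g 1) + C * (1 - π.real {0} - π.real {1}) := by
      rw [integral_add (hi1.mul_const _) (i01.const_mul _), integral_mul_const,
        integral_const_mul, integral_sub i0 hi1, integral_sub (integrable_const 1) hi0, e0, e1]
      simp
    rw [← this]
    refine integral_mono (integrable_psi ha .of_discrete .of_discrete (fun _ => hg 0) hg)
      ((hi1.mul_const _).add (i01.const_mul _)) fun k => ?_
    match k with
    | 0 => simp [psi]
    | 1 => simp
    | k + 2 => simpa using psi_le ha (hg 0) (hg (k + 2))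
  have h2 : π.real {0} * psi (g 0) (g 1) ≤ ∫ k, psi (g k) (g (k + 1)) ∂π := by
    rw [← e0, ← integral_mul_const]
    refine integral_mono (hi0.mul_const _)
      (integrable_psi ha .of_discrete .of_discrete hg fun k => hg (k + 1)) fun k => ?_
    match k with
    | 0 => simp
    | k + 1 => simpa using psi_nonneg (ha.trans_le (hg (k + 1)).1) (ha.trans_le (hg (k + 2)).1)
  -- Since e^{-r} ≥ 1 - r, one has e^{-r}(1 + r) ≥ 1 - r².
  have h3 : 1 - π.real {0} - π.real {1} ≤ (r : ℝ) ^ 2 := by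
    rw [p0, p1]
    have := Real.add_one_le_exp (-(r : ℝ))
    nlinarith [r.2, mul_le_mul_of_nonneg_right this (show (0 : ℝ) ≤ 1 + r by positivity)]
  have h4 := mul_le_mul_of_nonneg_left h3 hC
  have h5 := mul_le_mul_of_nonneg_left h2 r.2
  have h6 : π.real {1} = r * π.real {0} := by rw [p0, p1]; ring
  rw [h6] at h1 h4
  have h7 : (r : ℝ) = r.1 := rfl
  rw [← h7] at h5
  linarith

theorem ent_map {A B : Type*} [MeasurableSpace A] [MeasurableSpace B] {α : Measure A}
    {T : A → B} (hT : Measurable T) {g : B → ℝ} (hg : Measurable g) :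
    ent (α.map T) g = ent α (g ∘ T) := by
  have hl : Measurable fun x => g x * Real.log (g x) := hg.mul hg.log
  unfold ent
  rw [integral_map hT.aemeasurable hg.aestronglyMeasurable,
    integral_map hT.aemeasurable hl.aestronglyMeasurable]
  rfl

/-- The law of mean r + s is the image of a product under addition, and a unit shift of either
summand is a unit shift of the sum. Hence both the energy coefficients and the errors add up. -/
theorem ent_poissonMeasure_add_le {a b : ℝ} (ha : 0 < a) {r s : ℝ≥0} {d e : ℝ}
    (hr : ∀ g : ℕ → ℝ, (∀ x, g x ∈ Set.Icc a b) →
      ent (poissonMeasure r) g ≤ r * ∫ k, psi (g k) (g (k + 1)) ∂(poissonMeasure r) + d)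
    (hs : ∀ g : ℕ → ℝ, (∀ x, g x ∈ Set.Icc a b) →
      ent (poissonMeasure s) g ≤ s * ∫ k, psi (g k) (g (k + 1)) ∂(poissonMeasure s) + e)
    {g : ℕ → ℝ} (hg : ∀ x, g x ∈ Set.Icc a b) :
    ent (poissonMeasure (r + s)) g ≤
      (r + s : ℝ≥0) * ∫ k, psi (g k) (g (k + 1)) ∂(poissonMeasure (r + s)) + (d + e) := by
  have hc : poissonMeasure (r + s) =
      ((poissonMeasure r).prod (poissonMeasure s)).map fun z => z.1 + z.2 := by
    rw [← poissonMeasure_conv_poissonMeasure]; rfl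
  have h := ent_prod_le (α := poissonMeasure r) (β := poissonMeasure s) ha (I := Unit) (J := Unit)
    (S := fun _ k => k + 1) (T := fun _ k => k + 1) (r := fun _ => r) (s := fun _ => s)
    (d := d) (e := e) (fun _ => .of_discrete) (fun _ => .of_discrete)
    (fun g _ hg => by simpa using hr g hg) (fun g _ hg => by simpa using hs g hg)
    (G := fun z => g (z.1 + z.2)) .of_discrete fun _ => hg _
  rw [hc, ent_map .of_discrete .of_discrete, integral_map .of_discrete .of_discrete]
  refine h.trans (le_of_eq ?_)
  simp only [Finset.univ_unique, Finset.sum_singleton, NNReal.coe_add,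
    add_right_comm _ 1, ← add_assoc]
  ring

theorem ent_poissonMeasure_le {a b : ℝ} (ha : 0 < a) (r : ℝ≥0) {g : ℕ → ℝ}
    (hg : ∀ x, g x ∈ Set.Icc a b) :
    ent (poissonMeasure r) g ≤ r * ∫ k, psi (g k) (g (k + 1)) ∂(poissonMeasure r) := by
  set C := (b - a) * (Real.log b - Real.log a)
  have step : ∀ (s : ℝ≥0) (n : ℕ) (g : ℕ → ℝ), (∀ x, g x ∈ Set.Icc a b) →
      ent (poissonMeasure (n * s)) g ≤
        (n * s : ℝ≥0) * ∫ k, psi (g k) (g (k + 1)) ∂(poissonMeasure (n * s)) +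
          n * (C * s ^ 2) := by
    intro s n
    induction n with
    | zero =>
      intro g hg
      have := ent_poissonMeasure_le_add_sq ha 0 hg
      simpa using this
    | succ n ih =>
      intro g hg
      have := ent_poissonMeasure_add_le ha ih (fun g hg => ent_poissonMeasure_le_add_sq ha s hg) hg
      have hn : ((n + 1 : ℕ) : ℝ≥0) * s = n * s + s := by push_cast; ring
      rw [hn]
      refine this.trans (le_of_eq ?_)
      push_cast
      ring
  have lim : ∀ n : ℕ, ent (poissonMeasure r) g ≤
      r * ∫ k, psi (g k) (g (k + 1)) ∂(poissonMeasure r) + C * r ^ 2 * (1 / ((n : ℝ) + 1)) := by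
    intro n
    -- Splitting r into n + 1 equal parts leaves the error (n + 1) C (r / (n + 1))² = C r² / (n +
    -- 1), which tends to zero.
    have h := step (r / (n + 1 : ℕ)) (n + 1) g hg
    have hn : ((n + 1 : ℕ) : ℝ≥0) * (r / (n + 1 : ℕ)) = r := by
      field_simp
    rw [hn] at h
    refine h.trans (le_of_eq ?_)
    push_cast
    field_simp
  have ht := (tendsto_one_div_add_atTop_nhds_zero_nat (𝕜 := ℝ)).const_mul (C * (r : ℝ) ^ 2)
  have ht2 := ht.const_add (r * ∫ k, psi (g k) (g (k + 1)) ∂(poissonMeasure r))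
  simp only [mul_zero, add_zero] at ht2
  exact ge_of_tendsto' ht2 lim

theorem ent_pi_poissonMeasure_le {a b : ℝ} (ha : 0 < a) {n : ℕ} (r : Fin n → ℝ≥0)
    {g : (Fin n → ℕ) → ℝ} (hg : ∀ x, g x ∈ Set.Icc a b) :
    ent (Measure.pi fun i => poissonMeasure (r i)) g ≤
      ∑ i, r i * ∫ k, psi (g k) (g (k + Pi.single i 1))
        ∂(Measure.pi fun i => poissonMeasure (r i)) := by
  induction n with
  | zero =>
    have hc : ∀ k, g k = g 0 := fun k => congrArg g (Subsingleton.elim _ _)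
    simp [ent, hc]
  | succ n ih =>
    have hmp := (measurePreserving_piFinSuccAbove (fun i => poissonMeasure (r i)) 0).symm
    have h := ent_prod_le (α := poissonMeasure (r 0))
      (β := Measure.pi fun i : Fin n => poissonMeasure (r i.succ)) ha (I := Unit) (J := Fin n)
      (S := fun _ k => k + 1) (T := fun j k => k + Pi.single j 1) (r := fun _ => r 0)
      (s := fun i => r i.succ) (d := 0) (e := 0) (fun _ => .of_discrete) (fun _ => .of_discrete)
      (fun g _ hg => by simpa using ent_poissonMeasure_le ha (r 0) hg)
      (fun g _ hg => by simpa using ih (fun i => r i.succ) hg)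
      (G := fun z => g (Fin.cons z.1 z.2)) .of_discrete fun _ => hg _
    have hc : ∀ z : ℕ × (Fin n → ℕ),
        (MeasurableEquiv.piFinSuccAbove (fun _ => ℕ) (0 : Fin (n + 1))).symm z =
          Fin.cons z.1 z.2 := fun z => by
      simp [MeasurableEquiv.piFinSuccAbove, Fin.insertNthEquiv]
    rw [← hmp.map_eq, ent_map .of_discrete .of_discrete, Fin.sum_univ_succ]
    simp only [integral_map (μ := (poissonMeasure (r 0)).prod _) .of_discrete
      (.of_discrete : AEStronglyMeasurable (fun k => psi (g k) (g (k + _))) _)]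
    have s0 : ∀ z : ℕ × (Fin n → ℕ), (Fin.cons z.1 z.2 + Pi.single 0 1 : Fin (n + 1) → ℕ) =
        Fin.cons (z.1 + 1) z.2 := fun z => by
      ext i; refine Fin.cases ?_ (fun j => ?_) i <;> simp
    have s1 : ∀ (z : ℕ × (Fin n → ℕ)) (j : Fin n),
        (Fin.cons z.1 z.2 + Pi.single j.succ 1 : Fin (n + 1) → ℕ) =
        Fin.cons z.1 (z.2 + Pi.single j 1) := fun z j => by
      ext i; refine Fin.cases ?_ (fun l => ?_) i <;> simp [Pi.single_apply]
    simp only [Fin.succAbove_zero, Function.comp_def, hc, s0, s1]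
    simpa using h

/-! ### Counts and addition of points -/

theorem measurable_count {X : Type*} [MeasurableSpace X] {B : Set X} (hB : MeasurableSet B) :
    Measurable fun ξ : CountingMeasure X => ξ.1 B :=
  (Measure.measurable_coe hB).comp measurable_subtype_coe

theorem addPoint_apply {X : Type*} [MeasurableSpace X] (ξ : CountingMeasure X) (x : X) {B : Set X}
    (hB : MeasurableSet B) : (addPoint ξ x).1 B = ξ.1 B + B.indicator 1 x := by
  simp [addPoint, hB]

theorem measurable_countingMeasure {Y X : Type*} [MeasurableSpace Y] [MeasurableSpace X]
    {T : Y → CountingMeasure X} (hT : ∀ B, MeasurableSet B → Measurable fun y => (T y).1 B) :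
    Measurable T :=
  Measurable.subtype_mk (Measure.measurable_of_measurable_coe (fun y => (T y).1) hT)

theorem measurable_addPoint {X : Type*} [MeasurableSpace X] :
    Measurable fun z : CountingMeasure X × X => addPoint z.1 z.2 := by
  refine measurable_countingMeasure fun B hB => ?_
  simp only [addPoint_apply _ _ hB]
  exact ((measurable_count hB).comp measurable_fst).add
    ((measurable_one.indicator hB).comp measurable_snd)

instance isProbabilityMeasure_poissonLaw (m : ℝ≥0∞) : IsProbabilityMeasure (poissonLaw m) := by
  unfold poissonLaw
  split_ifs
  · infer_instance
  · exact Measure.isProbabilityMeasure_map .of_discrete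

theorem poissonLaw_of_ne_top {m : ℝ≥0∞} (hm : m ≠ ∞) :
    poissonLaw m = (poissonMeasure m.toNNReal).map (fun n : ℕ => (n : ℝ≥0∞)) :=
  if_neg hm

theorem lintegral_poissonLaw {m : ℝ≥0∞} (hm : m ≠ ∞) {φ : ℝ≥0∞ → ℝ≥0∞} (hφ : Measurable φ) :
    ∫⁻ z, φ z ∂(poissonLaw m) = ∑' n : ℕ,
      ENNReal.ofReal (Real.exp (-m.toNNReal) * m.toNNReal ^ n / n.factorial) * φ n := by
  rw [poissonLaw_of_ne_top hm, lintegral_map hφ .of_discrete, poissonMeasure,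
    lintegral_sum_measure]
  simp [lintegral_smul_measure]

/-- The Poisson weights satisfy (n + 1) p_{n+1} = m p_n. This is the Mecke equation for a single
count. -/
theorem lintegral_mul_id_poissonLaw {m : ℝ≥0∞} (hm : m ≠ ∞) {φ : ℝ≥0∞ → ℝ≥0∞}
    (hφ : Measurable φ) :
    ∫⁻ z, φ z * z ∂(poissonLaw m) = m * ∫⁻ z, φ (z + 1) ∂(poissonLaw m) := by
  lift m to ℝ≥0 using hm
  rw [lintegral_poissonLaw (φ := fun z => φ z * z) ENNReal.coe_ne_top (hφ.mul measurable_id),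
    lintegral_poissonLaw (φ := fun z => φ (z + 1)) ENNReal.coe_ne_top
      (hφ.comp (measurable_id.add_const 1)),
    tsum_eq_zero_add' ENNReal.summable, ← ENNReal.tsum_mul_left]
  simp only [Nat.cast_zero, mul_zero, zero_add, ENNReal.toNNReal_coe]
  refine tsum_congr fun n => ?_
  have h : (m : ℝ≥0∞) * ENNReal.ofReal (Real.exp (-m) * m ^ n / n.factorial) =
      ENNReal.ofReal (Real.exp (-m) * m ^ (n + 1) / (n + 1).factorial) * (n + 1 : ℕ) := by
    rw [← ENNReal.ofReal_coe_nnreal, ← ENNReal.ofReal_natCast, ← ENNReal.ofReal_mul m.coe_nonneg,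
      ← ENNReal.ofReal_mul (by positivity), Nat.factorial_succ]
    congr 1
    push_cast
    field_simp
    ring
  rw [← mul_assoc (m : ℝ≥0∞), h, Nat.cast_add, Nat.cast_one]
  ring

theorem lintegral_mul_coord_pi {J : Type*} [Fintype J] [DecidableEq J]
    (ν : J → Measure ℝ≥0∞) [∀ j, IsProbabilityMeasure (ν j)] {m : ℝ≥0∞} (hm : m ≠ ∞) {j₀ : J}
    (hj : ν j₀ = poissonLaw m) {φ : (J → ℝ≥0∞) → ℝ≥0∞} (hφ : Measurable φ) :
    ∫⁻ y, φ y * y j₀ ∂(Measure.pi ν) =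
      ∫⁻ y, m * φ (Function.update y j₀ (y j₀ + 1)) ∂(Measure.pi ν) := by
  have hu : Measurable fun y : J → ℝ≥0∞ => Function.update y j₀ (y j₀ + 1) := by
    refine measurable_pi_iff.2 fun j => ?_
    by_cases h : j = j₀
    · subst h; simpa using (measurable_pi_apply j).add_const 1
    · simpa [Function.update_of_ne h] using measurable_pi_apply j
  refine lintegral_eq_of_lmarginal_eq {j₀} (hφ.mul (measurable_pi_apply j₀))
    ((hφ.comp hu).const_mul m) (funext fun y => ?_)
  rw [lmarginal_singleton, lmarginal_singleton, hj]
  simp only [Function.update_self, Function.update_idem]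
  have hφ' : Measurable fun z => φ (Function.update y j₀ z) := hφ.comp (measurable_update y)
  rw [lintegral_mul_id_poissonLaw hm hφ',
    lintegral_const_mul m (f := fun z => φ (Function.update y j₀ (z + 1)))
      (hφ'.comp (measurable_id.add_const 1))]

/-! ### The law of a Poisson process -/

/-- The joint law of the counts of finitely many disjoint sets under a Poisson process. -/
def IsPoissonLaw {X : Type*} [MeasurableSpace X] (Q : Measure (CountingMeasure X))
    (μ : Measure X) : Prop :=
  ∀ (n : ℕ) (C : Fin n → Set X), (∀ i, MeasurableSet (C i)) →
    (Pairwise fun i j => Disjoint (C i) (C j)) →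
    Q.map (fun ξ i => ξ.1 (C i)) = Measure.pi fun i => poissonLaw (μ (C i))

theorem IsPoissonProcess.isPoissonLaw {Ω X : Type*} [MeasurableSpace Ω] [MeasurableSpace X]
    {P : Measure Ω} [IsProbabilityMeasure P] {μ : Measure X} {η : Ω → CountingMeasure X}
    (hη : IsPoissonProcess η μ P) : IsPoissonLaw (P.map η) μ := by
  intro n C hC hd
  have hm : ∀ i, Measurable fun ω => (η ω).1 (C i) := fun i =>
    (measurable_count (hC i)).comp hη.measurable
  rw [Measure.map_map (measurable_pi_iff.2 fun i => measurable_count (hC i)) hη.measurable]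
  have := (iIndepFun_iff_map_fun_eq_pi_map fun i => (hm i).aemeasurable).1 (hη.indep n C hC hd)
  simp only [hη.law _ (hC _)] at this
  exact this

theorem IsPoissonLaw.map_counts {X : Type*} [MeasurableSpace X] {Q : Measure (CountingMeasure X)}
    {μ : Measure X} (hQ : IsPoissonLaw Q μ) {J : Type*} [Fintype J] {C : J → Set X}
    (hC : ∀ j, MeasurableSet (C j)) (hd : Pairwise fun i j => Disjoint (C i) (C j)) :
    Q.map (fun ξ j => ξ.1 (C j)) = Measure.pi fun j => poissonLaw (μ (C j)) := by
  let e := (Fintype.equivFin J).symm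
  have h := hQ _ (fun i => C (e i)) (fun i => hC _) fun i j hij => hd (e.injective.ne hij)
  have h2 := measurePreserving_piCongrLeft (fun j => poissonLaw (μ (C j))) e
  rw [← h2.map_eq, ← h, Measure.map_map (MeasurableEquiv.measurable _)
    (measurable_pi_iff.2 fun i => measurable_count (hC _))]
  congr 1
  funext ξ j
  obtain ⟨i, rfl⟩ := e.surjective j
  simp [MeasurableEquiv.coe_piCongrLeft]

theorem IsPoissonLaw.map_count {X : Type*} [MeasurableSpace X] {Q : Measure (CountingMeasure X)}
    {μ : Measure X} (hQ : IsPoissonLaw Q μ) {B : Set X} (hB : MeasurableSet B) :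
    Q.map (fun ξ => ξ.1 B) = poissonLaw (μ B) := by
  have h := hQ.map_counts (J := Unit) (C := fun _ => B) (fun _ => hB)
    fun i j hij => (hij rfl).elim
  have h2 := congrArg (Measure.map fun y : Unit → ℝ≥0∞ => y ()) h
  rw [Measure.map_map (measurable_pi_apply _)
    (measurable_pi_iff.2 fun i => measurable_count hB)] at h2
  exact h2.trans (measurePreserving_eval (fun _ : Unit => poissonLaw (μ B)) ()).map_eq

theorem IsPoissonLaw.ae_count_ne_top {X : Type*} [MeasurableSpace X]
    {Q : Measure (CountingMeasure X)} {μ : Measure X} (hQ : IsPoissonLaw Q μ) {B : Set X}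
    (hB : MeasurableSet B) (hμ : μ B ≠ ∞) : ∀ᵐ ξ ∂Q, ξ.1 B ≠ ∞ := by
  have h : ∀ᵐ z ∂(poissonLaw (μ B)), z ≠ ∞ := by
    rw [poissonLaw_of_ne_top hμ, ae_map_iff (p := fun z : ℝ≥0∞ => z ≠ ∞)
      Measurable.of_discrete.aemeasurable (measurableSet_singleton _).compl]
    exact Filter.Eventually.of_forall fun n => ENNReal.natCast_ne_top n
  rw [← hQ.map_count hB] at h
  exact ae_of_ae_map (measurable_count hB).aemeasurable h

theorem CountingMeasure.exists_count_eq_natCast {X : Type*} [MeasurableSpace X]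
    (ξ : CountingMeasure X) {B : Set X} (hB : MeasurableSet B) (h : ξ.1 B ≠ ∞) :
    ∃ n : ℕ, ξ.1 B = n := by
  obtain ⟨n, hn⟩ := ξ.2.2 B hB
  induction n using ENat.recTopCoe with
  | top => simp [hn] at h
  | coe n => exact ⟨n, by simpa using hn⟩

/-! ### The Mecke equation -/

/-- A point added in `C j₀` raises that count by one and leaves the other counts alone, so the inner
integrand is constant on `C j₀`; what remains is the one-coordinate identity for a product law. -/
theorem IsPoissonLaw.lintegral_counts_mul {X : Type*} [MeasurableSpace X]
    {Q : Measure (CountingMeasure X)} {μ : Measure X} (hQ : IsPoissonLaw Q μ)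
    {J : Type*} [Fintype J] {C : J → Set X} (hC : ∀ j, MeasurableSet (C j))
    (hd : Pairwise fun i j => Disjoint (C i) (C j)) {j₀ : J} (hj : μ (C j₀) ≠ ∞)
    {φ : (J → ℝ≥0∞) → ℝ≥0∞} (hφ : Measurable φ) :
    ∫⁻ ξ, φ (fun j => ξ.1 (C j)) * ξ.1 (C j₀) ∂Q =
      ∫⁻ ξ, ∫⁻ x in C j₀, φ (fun j => (addPoint ξ x).1 (C j)) ∂μ ∂Q := by
  classical
  have hm : Measurable fun (ξ : CountingMeasure X) j => ξ.1 (C j) :=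
    measurable_pi_iff.2 fun i => measurable_count (hC i)
  have hu : Measurable fun y : J → ℝ≥0∞ => Function.update y j₀ (y j₀ + 1) := by
    refine measurable_pi_iff.2 fun j => ?_
    by_cases h : j = j₀
    · subst h; simpa using (measurable_pi_apply j).add_const 1
    · simpa [Function.update_of_ne h] using measurable_pi_apply j
  have h := lintegral_mul_coord_pi (fun j => poissonLaw (μ (C j))) hj rfl hφ
  rw [← hQ.map_counts hC hd, lintegral_map (f := fun y => φ y * y j₀)
      (hφ.mul (measurable_pi_apply j₀)) hm,
    lintegral_map (f := fun y => μ (C j₀) * φ (Function.update y j₀ (y j₀ + 1)))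
      ((hφ.comp hu).const_mul _) hm] at h
  rw [h]
  refine lintegral_congr fun ξ => ?_
  rw [setLIntegral_congr_fun (hC j₀) (g := fun _ => φ (Function.update (fun j => ξ.1 (C j)) j₀
    (ξ.1 (C j₀) + 1))), setLIntegral_const, mul_comm]
  intro x hx
  dsimp only
  congr 1
  funext j
  rw [addPoint_apply _ _ (hC j)]
  by_cases h : j = j₀
  · subst h; simp [hx]
  · have : x ∉ C j := fun hxj => Set.disjoint_left.1 (hd h) hxj hx
    simp [Function.update_of_ne h, this]

/-! ### Partitions into cells and cylinder events. -/

theorem measure_eq_sum_of_partition {X : Type*} [MeasurableSpace X] (ξ : Measure X) {J : Type*}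
    [Fintype J] {C : J → Set X} (hC : ∀ j, MeasurableSet (C j))
    (hd : Pairwise fun i j => Disjoint (C i) (C j)) (hU : ∀ x, ∃ j, x ∈ C j) {B : Set X}
    (p : J → Prop) [DecidablePred p] (hp : ∀ j, p j → C j ⊆ B)
    (hp' : ∀ j, ¬p j → Disjoint (C j) B) :
    ξ B = ∑ j, if p j then ξ (C j) else 0 := by
  have hB : B = ⋃ j ∈ Finset.univ.filter p, C j := by
    ext x
    simp only [Finset.mem_filter, Finset.mem_univ, true_and, Set.mem_iUnion, exists_prop]
    refine ⟨fun hx => ?_, fun ⟨j, hj, hx⟩ => hp j hj hx⟩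
    obtain ⟨j, hj⟩ := hU x
    exact ⟨j, by_contra fun h => Set.disjoint_left.1 (hp' j h) hj hx, hj⟩
  conv_lhs => rw [hB]
  rw [measure_biUnion_finset (fun i _ j _ h => hd h) fun j _ => hC j, Finset.sum_filter]

/-- The cell of points belonging to precisely those members of `t` that belong to `s`. -/
def cell {X I : Type*} (A : I → Set X) (t s : Finset I) : Set X :=
  {x | ∀ i ∈ t, x ∈ A i ↔ i ∈ s}

theorem measurableSet_cell {X I : Type*} [MeasurableSpace X] {A : I → Set X}
    (hA : ∀ i, MeasurableSet (A i)) (t s : Finset I) : MeasurableSet (cell A t s) := by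
  have : cell A t s = ⋂ i ∈ t, {x | x ∈ A i ↔ i ∈ s} := by ext; simp [cell]
  rw [this]
  refine Finset.measurableSet_biInter t fun i _ => ?_
  by_cases h : i ∈ s
  · simpa [h] using hA i
  · simp only [h, iff_false]
    exact (hA i).compl

theorem disjoint_cell {X I : Type*} {A : I → Set X} {t s s' : Finset I} (hs : s ⊆ t)
    (hs' : s' ⊆ t) (h : s ≠ s') : Disjoint (cell A t s) (cell A t s') := by
  refine Set.disjoint_left.2 fun x hx hx' => h ?_
  ext i
  exact ⟨fun hi => (hx' i (hs hi)).1 ((hx i (hs hi)).2 hi),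
    fun hi => (hx i (hs' hi)).1 ((hx' i (hs' hi)).2 hi)⟩

theorem exists_mem_cell {X I : Type*} (A : I → Set X) (t : Finset I) (x : X) :
    ∃ s ∈ t.powerset, x ∈ cell A t s := by
  classical
  exact ⟨t.filter fun i => x ∈ A i, by simp, fun i hi => by simp [hi]⟩

/-- The sets `A i` may overlap, so their counts need not be independent. They are sums of counts of
disjoint cells, and `C` can be separated as a cell of its own because it lies inside a single one.
-/
theorem IsPoissonLaw.lintegral_cylinder_cell {X : Type*} [MeasurableSpace X]
    {Q : Measure (CountingMeasure X)} {μ : Measure X} (hQ : IsPoissonLaw Q μ)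
    {I : Type*} {A : I → Set X} (hA : ∀ i, MeasurableSet (A i)) (t : Finset I)
    {D : I → Set ℝ≥0∞} (hD : ∀ i ∈ t, MeasurableSet (D i)) {s : Finset I} {C : Set X}
    (hC : MeasurableSet C) (hCs : C ⊆ cell A t s) (hμ : μ C ≠ ∞) :
    ∫⁻ ξ, {ξ : CountingMeasure X | ∀ i ∈ t, ξ.1 (A i) ∈ D i}.indicator 1 ξ * ξ.1 C ∂Q =
      ∫⁻ ξ, ∫⁻ x in C, {ξ : CountingMeasure X | ∀ i ∈ t, ξ.1 (A i) ∈ D i}.indicator 1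
        (addPoint ξ x) ∂μ ∂Q := by
  classical
  -- The index `none` stands for `C`, the others for the cells with `C` removed; only `C` has to
  -- have finite measure.
  let J := Option {s // s ∈ t.powerset}
  let K : J → Set X := fun o => o.elim C fun s => cell A t s.1 \ C
  have hK : ∀ o, MeasurableSet (K o) := by
    rintro (_ | s')
    · exact hC
    · exact (measurableSet_cell hA t s'.1).diff hC
  have hd : Pairwise fun i j => Disjoint (K i) (K j) := by
    rintro (_ | s₁) (_ | s₂) h
    · exact (h rfl).elim
    · exact Set.disjoint_sdiff_right
    · exact Set.disjoint_sdiff_left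
    · refine (disjoint_cell (Finset.mem_powerset.1 s₁.2) (Finset.mem_powerset.1 s₂.2)
        fun h' => h ?_).mono Set.sdiff_subset Set.sdiff_subset
      rw [Subtype.ext h']
  have hU : ∀ x, ∃ o, x ∈ K o := by
    intro x
    by_cases hx : x ∈ C
    · exact ⟨none, hx⟩
    · obtain ⟨s', hs', h⟩ := exists_mem_cell A t x
      exact ⟨some ⟨s', hs'⟩, h, hx⟩
  let p : I → J → Prop := fun i o => o.elim (i ∈ s) fun s' => i ∈ s'.1
  have hsum : ∀ (ξ : CountingMeasure X), ∀ i ∈ t,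
      ξ.1 (A i) = ∑ o, if p i o then ξ.1 (K o) else 0 := by
    intro ξ i hi
    refine measure_eq_sum_of_partition ξ.1 hK hd hU (p i) ?_ ?_
    · rintro (_ | s') h x hx
      · exact (hCs hx i hi).2 h
      · exact (hx.1 i hi).2 h
    · rintro (_ | s') h
      · exact Set.disjoint_left.2 fun x hx hx' => h ((hCs hx i hi).1 hx')
      · exact Set.disjoint_left.2 fun x hx hx' => h ((hx.1 i hi).1 hx')
  let E : Set (J → ℝ≥0∞) := {y | ∀ i ∈ t, (∑ o, if p i o then y o else 0) ∈ D i}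
  have hE : MeasurableSet E := by
    have : E = ⋂ i ∈ t, (fun y : J → ℝ≥0∞ => ∑ o, if p i o then y o else 0) ⁻¹' D i := by
      ext; simp [E]
    rw [this]
    refine Finset.measurableSet_biInter t fun i hi => ?_
    refine (Finset.measurable_fun_sum _ fun o _ => ?_) (hD i hi)
    by_cases h : p i o
    · simpa [h] using measurable_pi_apply o
    · simp [h]
  have hmem : ∀ ξ : CountingMeasure X,
      ({ξ : CountingMeasure X | ∀ i ∈ t, ξ.1 (A i) ∈ D i}.indicator 1 ξ : ℝ≥0∞) =
        E.indicator 1 fun o => ξ.1 (K o) := by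
    intro ξ
    have : (∀ i ∈ t, ξ.1 (A i) ∈ D i) ↔ (fun o => ξ.1 (K o)) ∈ E :=
      forall₂_congr fun i hi => by rw [hsum ξ i hi]
    simp only [Set.indicator_apply, Set.mem_ofPred_eq, this]
    rfl
  simp only [hmem]
  exact hQ.lintegral_counts_mul hK hd (j₀ := none) hμ (measurable_one.indicator hE)

theorem IsPoissonLaw.lintegral_cylinder {X : Type*} [MeasurableSpace X]
    {Q : Measure (CountingMeasure X)} {μ : Measure X} (hQ : IsPoissonLaw Q μ)
    [IsProbabilityMeasure Q] [SigmaFinite μ]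
    {I : Type*} {A : I → Set X} (hA : ∀ i, MeasurableSet (A i)) (t : Finset I)
    {D : I → Set ℝ≥0∞} (hD : ∀ i ∈ t, MeasurableSet (D i)) {C : Set X}
    (hC : MeasurableSet C) (hμ : μ C ≠ ∞) :
    ∫⁻ ξ, {ξ : CountingMeasure X | ∀ i ∈ t, ξ.1 (A i) ∈ D i}.indicator 1 ξ * ξ.1 C ∂Q =
      ∫⁻ ξ, ∫⁻ x in C, {ξ : CountingMeasure X | ∀ i ∈ t, ξ.1 (A i) ∈ D i}.indicator 1
        (addPoint ξ x) ∂μ ∂Q := by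
  have hcyl : MeasurableSet {ξ : CountingMeasure X | ∀ i ∈ t, ξ.1 (A i) ∈ D i} := by
    have : {ξ : CountingMeasure X | ∀ i ∈ t, ξ.1 (A i) ∈ D i} =
        ⋂ i ∈ t, (fun ξ : CountingMeasure X => ξ.1 (A i)) ⁻¹' D i := by ext; simp
    rw [this]
    exact Finset.measurableSet_biInter t fun i hi => measurable_count (hA i) (hD i hi)
  have hCU : C = ⋃ s ∈ t.powerset, C ∩ cell A t s := by
    ext x
    obtain ⟨s, hs, h⟩ := exists_mem_cell A t x
    simp only [Set.mem_iUnion, Set.mem_inter_iff, exists_prop]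
    exact ⟨fun hx => ⟨s, hs, hx, h⟩, fun ⟨_, _, hx, _⟩ => hx⟩
  have hd : Set.PairwiseDisjoint (t.powerset : Set (Finset I)) fun s => C ∩ cell A t s :=
    fun s hs s' hs' h => (disjoint_cell (Finset.mem_powerset.1 hs) (Finset.mem_powerset.1 hs')
      h).mono Set.inter_subset_right Set.inter_subset_right
  have hm : ∀ s ∈ t.powerset, MeasurableSet (C ∩ cell A t s) := fun s _ =>
    hC.inter (measurableSet_cell hA t s)
  have hξ : ∀ ξ : CountingMeasure X, ξ.1 C = ∑ s ∈ t.powerset, ξ.1 (C ∩ cell A t s) := by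
    intro ξ
    conv_lhs => rw [hCU]
    exact measure_biUnion_finset hd hm
  have hr : ∀ φ : X → ℝ≥0∞,
      ∫⁻ x in C, φ x ∂μ = ∑ s ∈ t.powerset, ∫⁻ x in C ∩ cell A t s, φ x ∂μ := by
    intro φ
    conv_lhs => rw [hCU]
    exact lintegral_biUnion_finset hd hm φ
  simp only [hξ, hr, Finset.mul_sum]
  rw [lintegral_finsetSum' (f := fun s ξ => {ξ : CountingMeasure X | ∀ i ∈ t,
        ξ.1 (A i) ∈ D i}.indicator 1 ξ * ξ.1 (C ∩ cell A t s)) _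
      fun s hs => ((measurable_one.indicator hcyl).mul
      (measurable_count (hm s hs))).aemeasurable,
    lintegral_finsetSum' (f := fun s ξ => ∫⁻ x in C ∩ cell A t s, {ξ : CountingMeasure X |
        ∀ i ∈ t, ξ.1 (A i) ∈ D i}.indicator 1 (addPoint ξ x) ∂μ) _
      fun s hs => (((measurable_one.indicator hcyl).comp
      measurable_addPoint).lintegral_prod_right').aemeasurable]
  exact Finset.sum_congr rfl fun s hs => hQ.lintegral_cylinder_cell hA t hD (hm s hs)
    Set.inter_subset_right (ne_top_of_le_ne_top hμ (measure_mono Set.inter_subset_left))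

/-- In this form the σ-field has the cylinder events as a generating π-system, and each of its
members depends on countably many evaluations only. -/
theorem measurableSpace_countingMeasure_eq (X : Type*) [MeasurableSpace X] :
    (inferInstance : MeasurableSpace (CountingMeasure X)) =
      ⨆ B : {B : Set X // MeasurableSet B},
        MeasurableSpace.comap (fun ξ : CountingMeasure X => ξ.1 B.1) inferInstance := by
  refine le_antisymm ?_ (iSup_le fun B => (measurable_count B.2).comap_le)
  have h : @Measurable _ _ (⨆ B : {B : Set X // MeasurableSet B},
      MeasurableSpace.comap (fun ξ : CountingMeasure X => ξ.1 B.1) inferInstance) _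
      (id : CountingMeasure X → CountingMeasure X) :=
    @measurable_countingMeasure _ X (⨆ B : {B : Set X // MeasurableSet B},
      MeasurableSpace.comap (fun ξ : CountingMeasure X => ξ.1 B.1) inferInstance) _ id
      fun B hB => Measurable.mono (comap_measurable _)
        (le_iSup (fun B : {B : Set X // MeasurableSet B} =>
          MeasurableSpace.comap (fun ξ : CountingMeasure X => ξ.1 B.1) inferInstance) ⟨B, hB⟩) le_rfl
  intro s hs
  exact h hs

/-- For fixed `C` of finite measure, both sides are finite measures in `A` that agree on the
π-system of cylinder events. General `C` is cut into countably many pieces of finite measure. -/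
theorem IsPoissonLaw.lintegral_count {X : Type*} [MeasurableSpace X]
    {Q : Measure (CountingMeasure X)} {μ : Measure X} (hQ : IsPoissonLaw Q μ)
    [IsProbabilityMeasure Q] [SigmaFinite μ] {A : Set (CountingMeasure X)} (hA : MeasurableSet A)
    {C : Set X} (hC : MeasurableSet C) :
    ∫⁻ ξ, A.indicator 1 ξ * ξ.1 C ∂Q =
      ∫⁻ ξ, ∫⁻ x in C, A.indicator 1 (addPoint ξ x) ∂μ ∂Q := by
  have hα : ∀ (C : Set X) {A : Set (CountingMeasure X)}, MeasurableSet A →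
      (Q.withDensity fun ξ => ξ.1 C) A = ∫⁻ ξ, A.indicator 1 ξ * ξ.1 C ∂Q := by
    intro C A hA
    rw [withDensity_apply _ hA, ← lintegral_indicator hA]
    refine lintegral_congr fun ξ => ?_
    by_cases h : ξ ∈ A <;> simp [h]
  have hβ : ∀ (C : Set X) {A : Set (CountingMeasure X)}, MeasurableSet A →
      ((Q.prod (μ.restrict C)).map fun z => addPoint z.1 z.2) A =
        ∫⁻ ξ, ∫⁻ x in C, A.indicator 1 (addPoint ξ x) ∂μ ∂Q := by
    intro C A hA
    rw [← lintegral_indicator_one hA, lintegral_map (measurable_one.indicator hA)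
      measurable_addPoint, lintegral_prod (fun z => A.indicator 1 (addPoint z.1 z.2))
      ((measurable_one.indicator hA).comp measurable_addPoint).aemeasurable]
  have fin : ∀ {C : Set X}, MeasurableSet C → μ C ≠ ∞ →
      ∫⁻ ξ, A.indicator 1 ξ * ξ.1 C ∂Q =
        ∫⁻ ξ, ∫⁻ x in C, A.indicator 1 (addPoint ξ x) ∂μ ∂Q := by
    intro C hC hμ
    have key : ∀ (t : Finset {B : Set X // MeasurableSet B})
        (f : {B : Set X // MeasurableSet B} → Set (CountingMeasure X)),
        (∀ B ∈ t, MeasurableSet[MeasurableSpace.comap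
          (fun ξ : CountingMeasure X => ξ.1 B.1) inferInstance] (f B)) →
        (Q.withDensity fun ξ => ξ.1 C) (⋂ B ∈ t, f B) =
          ((Q.prod (μ.restrict C)).map fun z => addPoint z.1 z.2) (⋂ B ∈ t, f B) := by
      intro t f hf
      have hmf : MeasurableSet (⋂ B ∈ t, f B) := Finset.measurableSet_biInter t fun B hB =>
        (measurable_count B.2).comap_le _ (hf B hB)
      rw [hα C hmf, hβ C hmf]
      have hD : ∀ B : {B : Set X // MeasurableSet B}, ∃ D : Set ℝ≥0∞,
          B ∈ t → MeasurableSet D ∧ (fun ξ : CountingMeasure X => ξ.1 B.1) ⁻¹' D = f B := by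
        intro B
        by_cases hB : B ∈ t
        · obtain ⟨D, hD⟩ := hf B hB
          exact ⟨D, fun _ => hD⟩
        · exact ⟨∅, fun h => (hB h).elim⟩
      choose D hD using hD
      have he : (⋂ B ∈ t, f B) = {ξ : CountingMeasure X | ∀ B ∈ t, ξ.1 B.1 ∈ D B} := by
        ext ξ
        simp only [Set.mem_iInter, Set.mem_ofPred_eq]
        exact forall₂_congr fun B hB => by rw [← (hD B hB).2]; rfl
      rw [he]
      exact hQ.lintegral_cylinder (fun B => B.2) t (fun B hB => (hD B hB).1) hC hμ
    -- The empty intersection gives equality of the total masses, both equal to μ(C); this supplies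
    -- the finiteness needed for uniqueness.
    have huniv := key ∅ (fun _ => Set.univ) (by simp)
    simp only [Finset.notMem_empty, Set.iInter_of_empty, Set.iInter_univ] at huniv
    have : IsFiniteMeasure (Q.withDensity fun ξ => ξ.1 C) := by
      refine ⟨?_⟩
      rw [huniv, hβ C .univ]
      simpa using hμ.lt_top
    have heq : (Q.withDensity fun ξ => ξ.1 C) =
        (Q.prod (μ.restrict C)).map fun z => addPoint z.1 z.2 := by
      refine ext_of_generate_finite (piiUnionInter (fun B : {B : Set X // MeasurableSet B} =>
        {s | MeasurableSet[MeasurableSpace.comap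
          (fun ξ : CountingMeasure X => ξ.1 B.1) inferInstance] s}) Set.univ) ?_
        (isPiSystem_piiUnionInter _ (fun B : {B : Set X // MeasurableSet B} => @MeasurableSpace.isPiSystem_measurableSet _
          (MeasurableSpace.comap (fun ξ : CountingMeasure X => ξ.1 B.1) inferInstance)) _) ?_ huniv
      · have h := generateFrom_piiUnionInter_measurableSet
          (fun B : {B : Set X // MeasurableSet B} => MeasurableSpace.comap
            (fun ξ : CountingMeasure X => ξ.1 B.1) inferInstance) Set.univ
        simp only [Set.mem_univ, iSup_pos] at h
        exact (measurableSpace_countingMeasure_eq X).trans h.symm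
      · rintro _ ⟨t, -, f, hf, rfl⟩
        exact key t f hf
    rw [← hα C hA, heq, hβ C hA]
  let S : ℕ → Set X := disjointed (spanningSets μ)
  have hS : ∀ l, MeasurableSet (S l) :=
    MeasurableSet.disjointed fun l => measurableSet_spanningSets μ l
  have hSμ : ∀ l, μ (S l) ≠ ∞ := fun l => ne_top_of_le_ne_top
    (measure_spanningSets_lt_top μ l).ne (measure_mono (disjointed_subset _ l))
  have hCU : C = ⋃ l, C ∩ S l := by
    rw [← Set.inter_iUnion, iUnion_disjointed, iUnion_spanningSets, Set.inter_univ]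
  have hd : Pairwise (Function.onFun Disjoint fun l => C ∩ S l) := fun i j hij =>
    (disjoint_disjointed _ hij).mono Set.inter_subset_right Set.inter_subset_right
  have hξ : ∀ ξ : CountingMeasure X, ξ.1 C = ∑' l, ξ.1 (C ∩ S l) := by
    intro ξ
    conv_lhs => rw [hCU]
    exact measure_iUnion hd fun l => hC.inter (hS l)
  have hr : ∀ φ : X → ℝ≥0∞, ∫⁻ x in C, φ x ∂μ = ∑' l, ∫⁻ x in C ∩ S l, φ x ∂μ := by
    intro φ
    conv_lhs => rw [hCU]
    exact lintegral_iUnion (fun l => hC.inter (hS l)) hd φ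
  simp only [hξ, hr, ← ENNReal.tsum_mul_left]
  rw [lintegral_tsum (f := fun l (ξ : CountingMeasure X) => A.indicator 1 ξ * ξ.1 (C ∩ S l))
      fun l => ((measurable_one.indicator hA).mul
        (measurable_count (hC.inter (hS l)))).aemeasurable,
    lintegral_tsum (f := fun l ξ => ∫⁻ x in C ∩ S l, A.indicator 1 (addPoint ξ x) ∂μ)
      fun l => (((measurable_one.indicator hA).comp
        measurable_addPoint).lintegral_prod_right').aemeasurable]
  exact tsum_congr fun l => fin (hC.inter (hS l))
    (ne_top_of_le_ne_top (hSμ l) (measure_mono Set.inter_subset_right))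

/-! ### An s-finite kernel representing the process, and the Mecke equation. -/

open Classical in
/-- The restriction of `ξ` to the cell `p.1` of a partition of `X` into sets of finite
`μ`-measure, on the event that this cell has precisely `p.2` points. -/
def countKernelPiece {X : Type*} [MeasurableSpace X] (μ : Measure X) [SigmaFinite μ]
    (p : ℕ × ℕ) : Kernel (CountingMeasure X) X :=
  Kernel.piecewise
    (measurable_count (MeasurableSet.disjointed (fun l => measurableSet_spanningSets μ l) p.1)
      (measurableSet_singleton (p.2 : ℝ≥0∞)))
    (Kernel.restrict ⟨Subtype.val, measurable_subtype_coe⟩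
      (MeasurableSet.disjointed (fun l => measurableSet_spanningSets μ l) p.1)) 0

theorem countKernelPiece_apply {X : Type*} [MeasurableSpace X] (μ : Measure X) [SigmaFinite μ]
    (p : ℕ × ℕ) (ξ : CountingMeasure X) : countKernelPiece μ p ξ =
      if ξ.1 (disjointed (spanningSets μ) p.1) = p.2 then
        ξ.1.restrict (disjointed (spanningSets μ) p.1) else 0 := by
  classical
  rw [countKernelPiece, Kernel.piecewise_apply]
  refine if_congr Iff.rfl ?_ rfl
  rw [Kernel.restrict_apply]
  rfl

/-- The kernel `ξ ↦ ξ`, cut off where `ξ` is infinite on the cells of a partition of `X` into sets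
of finite `μ`-measure. -/
def countKernel {X : Type*} [MeasurableSpace X] (μ : Measure X) [SigmaFinite μ] :
    Kernel (CountingMeasure X) X :=
  Kernel.sum (countKernelPiece μ)

/-- Fixing the number of points gives a bound on the mass that is uniform in ξ. The countable sum of
the pieces is therefore s-finite, as composition of a measure with a kernel requires. -/
instance isFiniteKernel_countKernelPiece {X : Type*} [MeasurableSpace X] (μ : Measure X)
    [SigmaFinite μ] (p : ℕ × ℕ) : IsFiniteKernel (countKernelPiece μ p) := by
  refine ⟨p.2, ENNReal.natCast_lt_top _, fun ξ => ?_⟩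
  rw [countKernelPiece_apply]
  split_ifs with h
  · rw [Measure.restrict_apply_univ, h]
  · simp

instance isSFiniteKernel_countKernel {X : Type*} [MeasurableSpace X] (μ : Measure X)
    [SigmaFinite μ] : IsSFiniteKernel (countKernel μ) :=
  Kernel.isSFiniteKernel_sum

/-- Almost surely every cell has a finite count, so for each cell exactly one value of the second
index contributes. -/
theorem IsPoissonLaw.countKernel_ae_eq {X : Type*} [MeasurableSpace X]
    {Q : Measure (CountingMeasure X)} {μ : Measure X} [SigmaFinite μ] (hQ : IsPoissonLaw Q μ) :
    ∀ᵐ ξ ∂Q, countKernel μ ξ = ξ.1 := by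
  have hS : ∀ l, MeasurableSet (disjointed (spanningSets μ) l) :=
    MeasurableSet.disjointed fun l => measurableSet_spanningSets μ l
  have h : ∀ᵐ ξ ∂Q, ∀ l, ξ.1 (disjointed (spanningSets μ) l) ≠ ∞ :=
    ae_all_iff.2 fun l => hQ.ae_count_ne_top (hS l) (ne_top_of_le_ne_top
      (measure_spanningSets_lt_top μ l).ne (measure_mono (disjointed_subset _ l)))
  filter_upwards [h] with ξ hξ
  ext B hB
  choose N hN using fun l => ξ.exists_count_eq_natCast (hS l) (hξ l)
  have hBU : B = ⋃ l, B ∩ disjointed (spanningSets μ) l := by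
    rw [← Set.inter_iUnion, iUnion_disjointed, iUnion_spanningSets, Set.inter_univ]
  have hd : Pairwise (Function.onFun Disjoint fun l => B ∩ disjointed (spanningSets μ) l) :=
    fun i j hij => (disjoint_disjointed _ hij).mono Set.inter_subset_right Set.inter_subset_right
  conv_rhs => rw [hBU, measure_iUnion hd fun l => hB.inter (hS l)]
  rw [countKernel, Kernel.sum_apply' _ _ hB, ENNReal.tsum_prod']
  refine tsum_congr fun l => ?_
  rw [tsum_eq_single (N l)]
  · rw [countKernelPiece_apply, if_pos (hN l), Measure.restrict_apply hB]
  · intro n hn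
    rw [countKernelPiece_apply, if_neg]
    · simp
    · rw [hN l]
      exact fun h => hn (by exact_mod_cast h.symm)

/-- The Mecke equation. -/
theorem IsPoissonLaw.mecke {X : Type*} [MeasurableSpace X]
    {Q : Measure (CountingMeasure X)} {μ : Measure X} (hQ : IsPoissonLaw Q μ)
    [IsProbabilityMeasure Q] [SigmaFinite μ] {h : CountingMeasure X × X → ℝ≥0∞}
    (hh : Measurable h) :
    ∫⁻ ξ, ∫⁻ x, h (ξ, x) ∂(countKernel μ ξ) ∂Q = ∫⁻ ξ, ∫⁻ x, h (addPoint ξ x, x) ∂μ ∂Q := by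
  have hT : Measurable fun z : CountingMeasure X × X => (addPoint z.1 z.2, z.2) :=
    measurable_addPoint.prodMk measurable_snd
  have hrect : ∀ A : Set (CountingMeasure X), MeasurableSet A → ∀ C : Set X, MeasurableSet C →
      (Q ⊗ₘ countKernel μ) (A ×ˢ C) = ∫⁻ ξ, A.indicator 1 ξ * ξ.1 C ∂Q := by
    intro A hA C hC
    rw [Measure.compProd_apply_prod hA hC, ← lintegral_indicator hA]
    refine lintegral_congr_ae (hQ.countKernel_ae_eq.mono fun ξ hξ => ?_)
    by_cases h : ξ ∈ A <;> simp [h, hξ]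
  -- Both measures agree on rectangles and give finite mass to `Set.univ ×ˢ spanningSets μ l`, which
  -- exhaust the space.
  have heq : Q ⊗ₘ countKernel μ = (Q.prod μ).map fun z => (addPoint z.1 z.2, z.2) := by
    refine Measure.ext_of_generateFrom_of_iUnion _ (fun l => Set.univ ×ˢ spanningSets μ l)
      generateFrom_prod.symm isPiSystem_prod ?_
      (fun l => ⟨_, Set.mem_ofPred_eq ▸ MeasurableSet.univ, _, measurableSet_spanningSets μ l, rfl⟩) ?_ ?_
    · rw [← Set.prod_iUnion, iUnion_spanningSets, Set.univ_prod_univ]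
    · intro l
      rw [hrect _ .univ _ (measurableSet_spanningSets μ l),
        hQ.lintegral_count .univ (measurableSet_spanningSets μ l)]
      simpa using (measure_spanningSets_lt_top μ l).ne
    · rintro _ ⟨A, hA, C, hC, rfl⟩
      have hAC : MeasurableSet (A ×ˢ C) := MeasurableSet.prod hA hC
      rw [hrect A hA C hC, hQ.lintegral_count hA hC, ← lintegral_indicator_one hAC,
        lintegral_map (measurable_one.indicator hAC) hT,
        lintegral_prod (fun z => (A ×ˢ C).indicator 1 (addPoint z.1 z.2, z.2))
          ((measurable_one.indicator hAC).comp hT).aemeasurable]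
      refine lintegral_congr fun ξ => ?_
      rw [← lintegral_indicator hC]
      refine lintegral_congr fun x => ?_
      by_cases h : x ∈ C <;> by_cases h' : addPoint ξ x ∈ A <;> simp [h, h']
  rw [← Measure.lintegral_compProd hh, heq, lintegral_map hh hT,
    lintegral_prod (fun z => h (addPoint z.1 z.2, z.2)) (hh.comp hT).aemeasurable]

/-! ### The projected inequality -/

/-- The event that the counts of the sets `C i` are given by `k`. -/
def countEvent {X J : Type*} [MeasurableSpace X] (C : J → Set X) (k : J → ℕ) :
    Set (CountingMeasure X) :=
  {ξ | ∀ j, ξ.1 (C j) = k j}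

theorem measurableSet_countEvent {X J : Type*} [MeasurableSpace X] [Countable J] {C : J → Set X}
    (hC : ∀ j, MeasurableSet (C j)) (k : J → ℕ) : MeasurableSet (countEvent C k) := by
  have : countEvent C k = ⋂ j, (fun ξ : CountingMeasure X => ξ.1 (C j)) ⁻¹' {(k j : ℝ≥0∞)} := by
    ext; simp [countEvent]
  rw [this]
  exact MeasurableSet.iInter fun j => measurable_count (hC j) (measurableSet_singleton _)

theorem disjoint_countEvent {X J : Type*} [MeasurableSpace X] (C : J → Set X) :
    Pairwise (Function.onFun Disjoint (countEvent C)) := fun k l hkl =>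
  Set.disjoint_left.2 fun ξ hk hl => hkl <| funext fun j => by
    exact_mod_cast (hk j).symm.trans (hl j)

theorem addPoint_mem_countEvent_iff {X J : Type*} [MeasurableSpace X] [DecidableEq J]
    {C : J → Set X} (hC : ∀ j, MeasurableSet (C j))
    (hd : Pairwise fun i j => Disjoint (C i) (C j)) {i : J} {x : X} (hx : x ∈ C i)
    (ξ : CountingMeasure X) (k : J → ℕ) :
    addPoint ξ x ∈ countEvent C (k + Pi.single i 1) ↔ ξ ∈ countEvent C k := by
  refine forall_congr' fun j => ?_
  rw [addPoint_apply _ _ (hC j)]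
  by_cases h : j = i
  · subst h
    simp [hx]
  · have : x ∉ C j := fun hxj => Set.disjoint_left.1 (hd h) hxj hx
    simp [this, h]

theorem IsPoissonLaw.measure_countEvent {X : Type*} [MeasurableSpace X]
    {Q : Measure (CountingMeasure X)} {μ : Measure X} (hQ : IsPoissonLaw Q μ) {J : Type*} [Fintype J]
    {C : J → Set X} (hC : ∀ j, MeasurableSet (C j))
    (hd : Pairwise fun i j => Disjoint (C i) (C j)) (hμ : ∀ j, μ (C j) ≠ ∞) (k : J → ℕ) :
    Q (countEvent C k) = Measure.pi (fun j => poissonMeasure (μ (C j)).toNNReal) {k} := by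
  have he : countEvent C k =
      (fun (ξ : CountingMeasure X) j => ξ.1 (C j)) ⁻¹' {fun j => (k j : ℝ≥0∞)} := by
    ext ξ
    simp [countEvent, funext_iff]
  rw [he, ← Measure.map_apply (measurable_pi_iff.2 fun j => measurable_count (hC j))
    (measurableSet_singleton _), hQ.map_counts hC hd, Measure.pi_singleton, Measure.pi_singleton]
  refine Finset.prod_congr rfl fun j _ => ?_
  rw [poissonLaw_of_ne_top (hμ j), Measure.map_apply .of_discrete (measurableSet_singleton _)]
  congr 1
  ext l
  simp

section

variable {X : Type*} [MeasurableSpace X] {Q : Measure (CountingMeasure X)} {μ : Measure X}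
  [IsProbabilityMeasure Q] [SigmaFinite μ]

/-- Mecke's equation for `1_{C i}(x)` times `H` on the event with counts `k + Pi.single i 1`.
Reading it backwards, a configuration in that event has `k i + 1` points of `C i` that could have
been the added one. -/
theorem IsPoissonLaw.lintegral_countEvent (hQ : IsPoissonLaw Q μ) {J : Type*} [Fintype J]
    [DecidableEq J] {C : J → Set X} (hC : ∀ j, MeasurableSet (C j))
    (hd : Pairwise fun i j => Disjoint (C i) (C j)) (i : J) (k : J → ℕ)
    {H : CountingMeasure X → ℝ≥0∞} (hH : Measurable H) :
    ∫⁻ ξ in countEvent C k, ∫⁻ x in C i, H (addPoint ξ x) ∂μ ∂Q =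
      (k i + 1) * ∫⁻ ξ in countEvent C (k + Pi.single i 1), H ξ ∂Q := by
  have hE := measurableSet_countEvent hC (k + Pi.single i 1)
  have hm := hQ.mecke (h := fun z => (C i).indicator 1 z.2 *
    (countEvent C (k + Pi.single i 1)).indicator H z.1)
    (((measurable_one.indicator (hC i)).comp measurable_snd).mul
      ((hH.indicator hE).comp measurable_fst))
  calc _ = ∫⁻ ξ, ∫⁻ x, (C i).indicator 1 x *
          (countEvent C (k + Pi.single i 1)).indicator H (addPoint ξ x) ∂μ ∂Q := by
        rw [← lintegral_indicator (measurableSet_countEvent hC k)]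
        refine lintegral_congr fun ξ => ?_
        have : ∀ x, (C i).indicator 1 x *
            (countEvent C (k + Pi.single i 1)).indicator H (addPoint ξ x) =
            (C i).indicator (fun x =>
              (countEvent C k).indicator (fun ξ => H (addPoint ξ x)) ξ) x := by
          intro x
          by_cases hx : x ∈ C i
          · have hiff := addPoint_mem_countEvent_iff hC hd hx ξ k
            by_cases hξ : ξ ∈ countEvent C k
            · simp [hx, hξ, hiff.2 hξ]
            · simp [hx, hξ, mt hiff.1 hξ]
          · simp [hx]
        simp only [this]
        rw [lintegral_indicator (hC i)]
        by_cases hξ : ξ ∈ countEvent C k <;> simp [hξ]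
    _ = _ := by
        rw [← hm, ← lintegral_indicator hE, ← lintegral_const_mul _ (hH.indicator hE)]
        refine lintegral_congr_ae (hQ.countKernel_ae_eq.mono fun ξ hξ => ?_)
        dsimp only
        rw [hξ, lintegral_mul_const _ (measurable_one.indicator (hC i)),
          lintegral_indicator_one (hC i)]
        by_cases h : ξ ∈ countEvent C (k + Pi.single i 1)
        · have := h i
          simp only [Pi.add_apply, Pi.single_eq_same, Nat.cast_add, Nat.cast_one] at this
          rw [this]
        · simp [h]

/-- On the product of the event and `C i`, the mean of `G ξ` is `g k`. The mean of `G (addPoint ξ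
x)` is `g (k + Pi.single i 1)`, by `lintegral_countEvent` for `G` and for the constant 1. Jensen's
inequality for `psi` then applies. -/
theorem IsPoissonLaw.psi_le_lintegral (hQ : IsPoissonLaw Q μ) {J : Type*} [Fintype J]
    [DecidableEq J] {C : J → Set X} (hC : ∀ j, MeasurableSet (C j))
    (hd : Pairwise fun i j => Disjoint (C i) (C j)) (hμ : ∀ j, μ (C j) ≠ ∞)
    {a b : ℝ} (ha : 0 < a) {G : CountingMeasure X → ℝ} (hG : Measurable G)
    (hG' : ∀ ξ, G ξ ∈ Set.Icc a b) {g : (J → ℕ) → ℝ} (hg' : ∀ k, g k ∈ Set.Icc a b)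
    (hg : ∀ k, Q.real (countEvent C k) * g k = ∫ ξ in countEvent C k, G ξ ∂Q) (i : J)
    (k : J → ℕ) :
    μ (C i) * (ENNReal.ofReal (psi (g k) (g (k + Pi.single i 1))) * Q (countEvent C k)) ≤
      ∫⁻ ξ in countEvent C k, ∫⁻ x in C i,
        ENNReal.ofReal (psi (G ξ) (G (addPoint ξ x))) ∂μ ∂Q := by
  set E := countEvent C k
  set E' := countEvent C (k + Pi.single i 1)
  have : Fact (μ (C i) < ∞) := ⟨(hμ i).lt_top⟩
  set ν := (Q.restrict E).prod (μ.restrict (C i))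
  have hGa : Measurable fun z : CountingMeasure X × X => G (addPoint z.1 z.2) :=
    hG.comp measurable_addPoint
  have hG1 : Measurable fun z : CountingMeasure X × X => G z.1 := hG.comp measurable_fst
  have hT : ν Set.univ = Q E * μ (C i) := by
    rw [← Set.univ_prod_univ, Measure.prod_prod]
    simp
  have hTr : ν.real Set.univ = Q.real E * μ.real (C i) := by simp [measureReal_def, hT]
  have h1 : ν.real Set.univ * g k = ∫ z, G z.1 ∂ν := by
    rw [integral_fun_fst (μ := Q.restrict E) (ν := μ.restrict (C i)) G, ← hg k, hTr]
    simp [E]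
    ring
  have hone : (Q E * μ (C i)) = (k i + 1) * Q E' := by
    have := hQ.lintegral_countEvent hC hd i k (H := fun _ => 1) measurable_const
    simpa [mul_comm, E, E'] using this
  have hone' : Q.real E * μ.real (C i) = (k i + 1) * Q.real E' := by
    have := congrArg ENNReal.toReal hone
    have hk : ((k i : ℝ≥0∞) + 1).toReal = k i + 1 := by
      rw [ENNReal.toReal_add (ENNReal.natCast_ne_top _) ENNReal.one_ne_top]; simp
    simpa [measureReal_def, ENNReal.toReal_mul, hk] using this
  have h2 : ν.real Set.univ * g (k + Pi.single i 1) = ∫ z, G (addPoint z.1 z.2) ∂ν := by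
    have hm := hQ.lintegral_countEvent hC hd i k (H := fun ξ => ENNReal.ofReal (G ξ))
      hG.ennreal_ofReal
    have e1 : ENNReal.ofReal (∫ z, G (addPoint z.1 z.2) ∂ν) =
        ENNReal.ofReal ((k i + 1) * ∫ ξ in E', G ξ ∂Q) := by
      rw [ofReal_integral_eq_lintegral_ofReal (integrable_of_mem_Icc hGa fun _ => hG' _)
        (Filter.Eventually.of_forall fun _ => (ha.trans_le (hG' _).1).le),
        ENNReal.ofReal_mul (by positivity),
        ofReal_integral_eq_lintegral_ofReal (integrable_of_mem_Icc hG fun _ => hG' _)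
        (Filter.Eventually.of_forall fun _ => (ha.trans_le (hG' _).1).le),
        lintegral_prod _ hGa.ennreal_ofReal.aemeasurable, hm,
        ENNReal.ofReal_add (by positivity) zero_le_one]
      simp [E']
    have e2 := (ENNReal.ofReal_eq_ofReal_iff
      (integral_nonneg fun z : CountingMeasure X × X => (ha.trans_le (hG' (addPoint z.1 z.2)).1).le)
      (mul_nonneg (by positivity) (integral_nonneg fun ξ => (ha.trans_le (hG' ξ).1).le))).1 e1
    rw [e2, ← hg, hTr, hone']
    ring
  have hJ := psi_jensen ha hG1 hGa (fun _ => hG' _) (fun _ => hG' _)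
    (ha.trans_le (hg' k).1) (ha.trans_le (hg' (k + Pi.single i 1)).1) h1 h2
  have hJ' := ENNReal.ofReal_le_ofReal hJ
  rw [ENNReal.ofReal_mul measureReal_nonneg, ofReal_measureReal, hT,
    ofReal_integral_eq_lintegral_ofReal (integrable_psi ha hG1 hGa (fun _ => hG' _) fun _ => hG' _)
      (Filter.Eventually.of_forall fun _ =>
        psi_nonneg (ha.trans_le (hG' _).1) (ha.trans_le (hG' _).1)),
    lintegral_prod _ (measurable_psi hG1 hGa).ennreal_ofReal.aemeasurable] at hJ'
  refine le_trans (le_of_eq ?_) hJ'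
  ring

theorem IsPoissonLaw.ent_pi_le (hQ : IsPoissonLaw Q μ) {n : ℕ} {C : Fin n → Set X}
    (hC : ∀ j, MeasurableSet (C j)) (hd : Pairwise fun i j => Disjoint (C i) (C j))
    (hμ : ∀ j, μ (C j) ≠ ∞) {a b : ℝ} (ha : 0 < a) {G : CountingMeasure X → ℝ}
    (hG : Measurable G) (hG' : ∀ ξ, G ξ ∈ Set.Icc a b) {g : (Fin n → ℕ) → ℝ}
    (hg' : ∀ k, g k ∈ Set.Icc a b)
    (hg : ∀ k, Q.real (countEvent C k) * g k = ∫ ξ in countEvent C k, G ξ ∂Q) :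
    ENNReal.ofReal (ent (Measure.pi fun j => poissonMeasure (μ (C j)).toNNReal) g) ≤
      ∫⁻ ξ, ∫⁻ x, ENNReal.ofReal (psi (G ξ) (G (addPoint ξ x))) ∂μ ∂Q := by
  set ρ := Measure.pi fun j => poissonMeasure (μ (C j)).toNNReal
  have hpos : ∀ j k, 0 ≤ psi (g k) (g (k + Pi.single j 1)) := fun j k =>
    psi_nonneg (ha.trans_le (hg' _).1) (ha.trans_le (hg' _).1)
  have hmeas : Measurable fun z : CountingMeasure X × X =>
      ENNReal.ofReal (psi (G z.1) (G (addPoint z.1 z.2))) :=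
    (measurable_psi (hG.comp measurable_fst) (hG.comp measurable_addPoint)).ennreal_ofReal
  calc _ ≤ ENNReal.ofReal (∑ j, (μ (C j)).toNNReal *
        ∫ k, psi (g k) (g (k + Pi.single j 1)) ∂ρ) :=
        ENNReal.ofReal_le_ofReal (ent_pi_poissonMeasure_le ha _ hg')
    _ = ∑ j, ∑' k, μ (C j) * (ENNReal.ofReal (psi (g k) (g (k + Pi.single j 1))) *
          Q (countEvent C k)) := by
        rw [ENNReal.ofReal_sum_of_nonneg fun j _ =>
          mul_nonneg NNReal.zero_le_coe (integral_nonneg (hpos j))]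
        refine Finset.sum_congr rfl fun j _ => ?_
        rw [ENNReal.ofReal_mul NNReal.zero_le_coe, ENNReal.ofReal_coe_nnreal,
          ENNReal.coe_toNNReal (hμ j), ENNReal.tsum_mul_left,
          ofReal_integral_eq_lintegral_ofReal
            (integrable_psi ha .of_discrete .of_discrete hg' fun k => hg' _)
            (Filter.Eventually.of_forall (hpos j)), lintegral_countable']
        simp only [hQ.measure_countEvent hC hd hμ, ρ]
    _ ≤ ∑ j, ∑' k, ∫⁻ ξ in countEvent C k, ∫⁻ x in C j,
          ENNReal.ofReal (psi (G ξ) (G (addPoint ξ x))) ∂μ ∂Q :=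
        Finset.sum_le_sum fun j _ => ENNReal.tsum_le_tsum fun k =>
          hQ.psi_le_lintegral hC hd hμ ha hG hG' hg' hg j k
    _ ≤ ∑ j, ∫⁻ ξ, ∫⁻ x in C j, ENNReal.ofReal (psi (G ξ) (G (addPoint ξ x))) ∂μ ∂Q := by
        refine Finset.sum_le_sum fun j _ => ?_
        rw [← lintegral_iUnion (measurableSet_countEvent hC) (disjoint_countEvent C)]
        exact setLIntegral_le_lintegral _ _
    _ = ∫⁻ ξ, ∫⁻ x in ⋃ j, C j, ENNReal.ofReal (psi (G ξ) (G (addPoint ξ x))) ∂μ ∂Q := by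
        rw [← lintegral_finsetSum' _ fun j _ => hmeas.lintegral_prod_right'.aemeasurable]
        refine lintegral_congr fun ξ => ?_
        rw [lintegral_iUnion hC hd, tsum_fintype]
    _ ≤ _ := lintegral_mono fun ξ => setLIntegral_le_lintegral _ _

/-- The `σ`-field generated by the counts of the sets `C j`. -/
@[reducible] def countSigma {X J : Type*} [MeasurableSpace X] (C : J → Set X) :
    MeasurableSpace (CountingMeasure X) :=
  MeasurableSpace.comap (fun ξ j => ξ.1 (C j)) inferInstance

/-- The modified logarithmic Sobolev inequality for the conditional expectation given the counts
of finitely many disjoint sets. -/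
theorem IsPoissonLaw.ent_condExp_le (hQ : IsPoissonLaw Q μ) {n : ℕ} {C : Fin n → Set X}
    (hC : ∀ j, MeasurableSet (C j)) (hd : Pairwise fun i j => Disjoint (C i) (C j))
    (hμ : ∀ j, μ (C j) ≠ ∞) {a b : ℝ} (ha : 0 < a) {G : CountingMeasure X → ℝ}
    (hG : Measurable G) (hG' : ∀ ξ, G ξ ∈ Set.Icc a b) :
    ENNReal.ofReal (ent Q (Q[G | countSigma C])) ≤
      ∫⁻ ξ, ∫⁻ x, ENNReal.ofReal (psi (G ξ) (G (addPoint ξ x))) ∂μ ∂Q := by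
  have hcounts : Measurable fun (ξ : CountingMeasure X) j => ξ.1 (C j) :=
    measurable_pi_iff.2 fun j => measurable_count (hC j)
  have hle : countSigma C ≤ Subtype.instMeasurableSpace := hcounts.comap_le
  have iG : Integrable G Q := integrable_of_mem_Icc hG hG'
  have hab : a ≤ b := by
    obtain ⟨ξ⟩ : Nonempty (CountingMeasure X) := nonempty_of_isProbabilityMeasure Q
    exact (hG' ξ).1.trans (hG' ξ).2
  obtain ⟨y, -, hy⟩ := (stronglyMeasurable_condExp (m := countSigma C) (f := G)
    (μ := Q)).exists_eq_measurable_comp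
  -- The factor `y` is controlled only almost surely; clamping puts `g` into [a, b] at every `k`,
  -- also on events of probability zero.
  let g : (Fin n → ℕ) → ℝ := fun k => max a (min b (y fun j => k j))
  have hg' : ∀ k, g k ∈ Set.Icc a b := fun k =>
    ⟨le_max_left _ _, max_le hab (min_le_left _ _)⟩
  -- An infinite count is sent to 0 here; this happens on a null set only.
  let N : CountingMeasure X → Fin n → ℕ := fun ξ j => ⌊(ξ.1 (C j)).toReal⌋₊
  have hN : Measurable N := measurable_pi_iff.2 fun j =>
    Nat.measurable_floor.comp (measurable_count (hC j)).ennreal_toReal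
  have hNmem : ∀ {ξ k}, ξ ∈ countEvent C k → N ξ = k := by
    intro ξ k h
    funext j
    simp [N, h j]
  have hfin : ∀ᵐ ξ ∂Q, ξ ∈ countEvent C (N ξ) := by
    have : ∀ᵐ ξ ∂Q, ∀ j, ξ.1 (C j) ≠ ∞ := ae_all_iff.2 fun j => hQ.ae_count_ne_top (hC j) (hμ j)
    filter_upwards [this] with ξ hξ j
    obtain ⟨l, hl⟩ := ξ.exists_count_eq_natCast (hC j) (hξ j)
    simp [N, hl]
  have hYlo : ∀ᵐ ξ ∂Q, a ≤ (Q[G | countSigma C]) ξ := by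
    have := condExp_mono (m := countSigma C) (integrable_const a) iG
      (Filter.Eventually.of_forall fun ξ => (hG' ξ).1)
    rwa [condExp_const hle] at this
  have hYhi : ∀ᵐ ξ ∂Q, (Q[G | countSigma C]) ξ ≤ b := by
    have := condExp_mono (m := countSigma C) iG (integrable_const b)
      (Filter.Eventually.of_forall fun ξ => (hG' ξ).2)
    rwa [condExp_const hle] at this
  have hY : Q[G | countSigma C] =ᵐ[Q] g ∘ N := by
    filter_upwards [hfin, hYlo, hYhi] with ξ h1 h2 h3
    have h4 : (Q[G | countSigma C]) ξ = y fun j => (N ξ j : ℝ≥0∞) := by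
      rw [hy]
      exact congrArg y (funext h1)
    simp only [Function.comp_apply, g, ← h4, min_eq_right h3, max_eq_right h2]
  have hg : ∀ k, Q.real (countEvent C k) * g k = ∫ ξ in countEvent C k, G ξ ∂Q := by
    intro k
    have hmE : MeasurableSet[countSigma C] (countEvent C k) := by
      refine ⟨{fun j => (k j : ℝ≥0∞)}, measurableSet_singleton _, ?_⟩
      ext ξ
      simp [countEvent, funext_iff]
    rw [← setIntegral_condExp hle iG hmE, setIntegral_congr_ae (g := fun _ => g k) (hle _ hmE),
      setIntegral_const, smul_eq_mul]
    filter_upwards [hY] with ξ hξ h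
    rw [hξ, Function.comp_apply, hNmem h]
  have hmap : Q.map N = Measure.pi fun j => poissonMeasure (μ (C j)).toNNReal := by
    refine Measure.ext_of_singleton fun k => ?_
    rw [Measure.map_apply hN (measurableSet_singleton k), ← hQ.measure_countEvent hC hd hμ]
    refine measure_congr ?_
    filter_upwards [hfin] with ξ hξ
    refine propext ⟨fun h => ?_, fun h => hNmem h⟩
    have : N ξ = k := h
    exact this ▸ hξ
  have hent : ent Q (Q[G | countSigma C]) = ent (Measure.pi fun j => poissonMeasure (μ (C j)).toNNReal) g := by
    rw [← hmap, ent_map hN .of_discrete]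
    unfold ent
    rw [integral_congr_ae hY]
    congr 1
    refine integral_congr_ae ?_
    filter_upwards [hY] with ξ hξ
    rw [hξ]
  rw [hent]
  exact hQ.ent_pi_le hC hd hμ ha hG hG' hg' hg

end

/-! ### Refining partitions and martingale convergence -/

/-- The sets depending on countably many of the `m i` form a σ-field that contains every `m i`. -/
theorem exists_countable_measurableSet_iSup {α ι : Type*} (m : ι → MeasurableSpace α) {s : Set α}
    (hs : MeasurableSet[⨆ i, m i] s) :
    ∃ T : Set ι, T.Countable ∧ MeasurableSet[⨆ i ∈ T, m i] s := by
  rw [MeasurableSpace.measurableSet_iSup] at hs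
  induction hs with
  | basic u hu =>
    obtain ⟨i, hi⟩ := hu
    have hle : m i ≤ ⨆ j ∈ ({i} : Set ι), m j := le_iSup₂_of_le i rfl le_rfl
    exact ⟨{i}, Set.countable_singleton i, hle _ hi⟩
  | empty => exact ⟨∅, Set.countable_empty, @MeasurableSet.empty α (⨆ j ∈ (∅ : Set ι), m j)⟩
  | compl t _ ih =>
    obtain ⟨T, hT, h⟩ := ih
    exact ⟨T, hT, h.compl⟩
  | iUnion u _ ih =>
    choose T hT h using ih
    refine ⟨⋃ n, T n, Set.countable_iUnion hT, MeasurableSet.iUnion fun n => ?_⟩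
    have hle : (⨆ i ∈ T n, m i) ≤ ⨆ i ∈ ⋃ n, T n, m i :=
      biSup_mono fun i hi => Set.mem_iUnion.2 ⟨n, hi⟩
    exact hle _ (h n)

theorem exists_countable_measurable_iSup {α ι : Type*} (m : ι → MeasurableSpace α) {f : α → ℝ}
    (hf : Measurable[⨆ i, m i] f) :
    ∃ T : Set ι, T.Countable ∧ Measurable[⨆ i ∈ T, m i] f := by
  choose T hT h using fun q : ℚ =>
    exists_countable_measurableSet_iSup m (hf (measurableSet_Iio (a := (q : ℝ))))
  refine ⟨⋃ q, T q, Set.countable_iUnion hT, ?_⟩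
  rw [BorelSpace.measurable_eq (α := ℝ), Real.borel_eq_generateFrom_Iio_rat]
  refine @measurable_generateFrom α ℝ (⨆ i ∈ ⋃ q, T q, m i) _ f fun s hs => ?_
  obtain ⟨q, rfl⟩ := Set.mem_iUnion.1 hs
  have hle : (⨆ i ∈ T q, m i) ≤ ⨆ i ∈ ⋃ q, T q, m i :=
    biSup_mono fun i hi => Set.mem_iUnion.2 ⟨q, hi⟩
  exact hle _ (h q)

theorem measurable_count_countSigma {X J : Type*} [MeasurableSpace X] (C : J → Set X) (j : J) :
    Measurable[countSigma C] fun ξ : CountingMeasure X => ξ.1 (C j) :=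
  (measurable_pi_apply j).comp (comap_measurable fun (ξ : CountingMeasure X) j => ξ.1 (C j))

theorem countSigma_le {X J : Type*} [MeasurableSpace X] {C : J → Set X}
    {m : MeasurableSpace (CountingMeasure X)}
    (h : ∀ j, Measurable[m] fun ξ : CountingMeasure X => ξ.1 (C j)) : countSigma C ≤ m :=
  (measurable_pi_iff.2 h).comap_le

/-- The index set of the cells of the partition generated by `A 0, …, A (n - 1)`, except for the
cell of the points that belong to none of these sets. -/
abbrev CellIndex (n : ℕ) : Type :=
  {s : Finset ℕ // s ∈ (Finset.range n).powerset ∧ s.Nonempty}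

instance fintype_cellIndex (n : ℕ) : Fintype (CellIndex n) :=
  Fintype.ofInjective (fun s : CellIndex n => (⟨s.1, s.2.1⟩ : (Finset.range n).powerset))
    fun _ _ h => Subtype.ext (congrArg (fun u : (Finset.range n).powerset => u.1) h)

/-- The cells of the partition generated by `A 0, …, A (n - 1)`. -/
def cells {X : Type*} (A : ℕ → Set X) (n : ℕ) (s : CellIndex n) : Set X :=
  cell A (Finset.range n) s.1

theorem disjoint_cells {X : Type*} (A : ℕ → Set X) (n : ℕ) :
    Pairwise fun s t => Disjoint (cells A n s) (cells A n t) := fun s t h =>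
  disjoint_cell (Finset.mem_powerset.1 s.2.1) (Finset.mem_powerset.1 t.2.1)
    fun h' => h (Subtype.ext h')

/-- This is why the empty index is left out of `CellIndex`: the remaining cells inherit finite
measure from the sets `A j`, whereas the points outside all `A j` may have infinite measure. -/
theorem exists_cells_subset {X : Type*} (A : ℕ → Set X) (n : ℕ) (s : CellIndex n) :
    ∃ j, cells A n s ⊆ A j := by
  obtain ⟨j, hj⟩ := s.2.2
  exact ⟨j, fun x hx => (hx j (Finset.mem_powerset.1 s.2.1 hj)).2 hj⟩

theorem cell_range_succ {X : Type*} (A : ℕ → Set X) (n : ℕ) {s : Finset ℕ}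
    (hs : s ⊆ Finset.range n) : cell A (Finset.range n) s =
      cell A (Finset.range (n + 1)) s ∪ cell A (Finset.range (n + 1)) (insert n s) := by
  have hn : n ∉ s := fun h => by simpa using hs h
  ext x
  simp only [cell, Set.mem_union, Set.mem_ofPred_eq, Finset.mem_range]
  constructor
  · intro h
    by_cases hx : x ∈ A n
    · refine Or.inr fun i hi => ?_
      rcases Nat.lt_succ_iff_lt_or_eq.1 hi with hi | rfl
      · simp [h i hi, hi.ne]
      · simp [hx]
    · refine Or.inl fun i hi => ?_
      rcases Nat.lt_succ_iff_lt_or_eq.1 hi with hi | rfl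
      · exact h i hi
      · simp [hx, hn]
  · rintro (h | h) i hi
    · exact h i (hi.trans n.lt_succ_self)
    · simpa [hi.ne] using h i (hi.trans n.lt_succ_self)

/-- The filtration generated by the counts of the cells of refining partitions. -/
def cellFiltration {X : Type*} [MeasurableSpace X] {A : ℕ → Set X}
    (hA : ∀ j, MeasurableSet (A j)) :
    Filtration ℕ (inferInstance : MeasurableSpace (CountingMeasure X)) where
  seq n := countSigma (cells A n)
  mono' := by
    refine monotone_nat_of_le_succ fun n => countSigma_le fun s => ?_
    have hs := Finset.mem_powerset.1 s.2.1
    have hss : s.1 ⊆ Finset.range (n + 1) := hs.trans (Finset.range_mono n.le_succ)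
    have his : insert n s.1 ⊆ Finset.range (n + 1) := Finset.insert_subset (by simp) hss
    have hn : n ∉ s.1 := fun h => by simpa using hs h
    -- Passing to level n + 1 splits a cell into its parts outside and inside `A n`, both with
    -- nonempty index.
    have h : (fun ξ : CountingMeasure X => ξ.1 (cells A n s)) = fun ξ : CountingMeasure X =>
        ξ.1 (cells A (n + 1) ⟨s.1, Finset.mem_powerset.2 hss, s.2.2⟩) +
        ξ.1 (cells A (n + 1) ⟨insert n s.1, Finset.mem_powerset.2 his, by simp⟩) := by
      funext ξ
      rw [cells, cell_range_succ A n hs, measure_union _ (measurableSet_cell hA _ _)]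
      · rfl
      · exact disjoint_cell hss his fun h => hn (h ▸ Finset.mem_insert_self n s.1)
    rw [h]
    exact (measurable_count_countSigma _ _).add (measurable_count_countSigma _ _)
  le' n := countSigma_le fun s => measurable_count (measurableSet_cell hA _ _)

theorem measurable_count_cellFiltration {X : Type*} [MeasurableSpace X] {A : ℕ → Set X}
    (hA : ∀ j, MeasurableSet (A j)) (j : ℕ) :
    Measurable[cellFiltration hA (j + 1)] fun ξ : CountingMeasure X => ξ.1 (A j) := by
  classical
  have h : (fun ξ : CountingMeasure X => ξ.1 (A j)) = fun ξ : CountingMeasure X =>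
      ∑ s : (Finset.range (j + 1)).powerset,
        if j ∈ s.1 then ξ.1 (cell A (Finset.range (j + 1)) s.1) else 0 := by
    funext ξ
    refine measure_eq_sum_of_partition ξ.1
      (C := fun s : (Finset.range (j + 1)).powerset => cell A (Finset.range (j + 1)) s.1)
      (fun s => measurableSet_cell hA _ _)
      (fun s t hst => disjoint_cell (Finset.mem_powerset.1 s.2) (Finset.mem_powerset.1 t.2)
        fun h => hst (Subtype.ext h)) (fun x => ?_) (fun s => j ∈ s.1)
      (fun s hs x hx => (hx j (by simp)).2 hs)
      (fun s hs => Set.disjoint_left.2 fun x hx hx' => hs ((hx j (by simp)).1 hx'))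
    obtain ⟨s, hs, hx⟩ := exists_mem_cell A (Finset.range (j + 1)) x
    exact ⟨⟨s, hs⟩, hx⟩
  rw [h]
  refine Finset.measurable_fun_sum _ fun s _ => ?_
  by_cases hj : j ∈ s.1
  · simp only [hj, if_true]
    exact measurable_count_countSigma (cells A (j + 1)) ⟨s.1, s.2, j, hj⟩
  · simp only [hj, if_false]
    exact measurable_const

theorem exists_measurable_iSup_cellFiltration {X : Type*} [MeasurableSpace X] (μ : Measure X)
    [SigmaFinite μ] {f : CountingMeasure X → ℝ} (hf : Measurable f) :
    ∃ (A : ℕ → Set X) (hA : ∀ j, MeasurableSet (A j)), (∀ j, μ (A j) ≠ ∞) ∧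
      Measurable[⨆ n, cellFiltration hA n] f := by
  obtain ⟨T, hT, hfT⟩ := exists_countable_measurable_iSup _
    (hf.mono (measurableSpace_countingMeasure_eq X).le le_rfl)
  -- The empty set is added so that the countable family is nonempty and can be enumerated by ℕ.
  obtain ⟨B, hB⟩ := (hT.insert ⟨∅, MeasurableSet.empty⟩).exists_eq_range (Set.insert_nonempty _ _)
  have hS : ∀ l, MeasurableSet (disjointed (spanningSets μ) l) :=
    MeasurableSet.disjointed fun l => measurableSet_spanningSets μ l
  -- Each `B i` is cut along a partition into sets of finite measure, the pairs (i, l) being coded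
  -- by one natural number; its count is the sum of the counts of its pieces.
  let A : ℕ → Set X := fun j => (B j.unpair.1).1 ∩ disjointed (spanningSets μ) j.unpair.2
  have hA : ∀ j, MeasurableSet (A j) := fun j => (B _).2.inter (hS _)
  refine ⟨A, hA, fun j => ne_top_of_le_ne_top (measure_spanningSets_lt_top μ j.unpair.2).ne
    (measure_mono (Set.inter_subset_right.trans (disjointed_subset _ _))), ?_⟩
  refine hfT.mono (iSup₂_le fun C hC => ?_) le_rfl
  obtain ⟨i, rfl⟩ : C ∈ Set.range B := hB ▸ Set.mem_insert_of_mem _ hC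
  refine Measurable.comap_le ?_
  have h : (fun ξ : CountingMeasure X => ξ.1 (B i).1) =
      fun ξ : CountingMeasure X => ∑' l, ξ.1 (A (Nat.pair i l)) := by
    funext ξ
    have hBU : (B i).1 = ⋃ l, A (Nat.pair i l) := by
      simp only [A, Nat.unpair_pair]
      rw [← Set.inter_iUnion, iUnion_disjointed, iUnion_spanningSets, Set.inter_univ]
    rw [hBU, measure_iUnion (fun k l hkl => ?_) fun l => hA _]
    simp only [A, Nat.unpair_pair]
    exact (disjoint_disjointed _ hkl).mono Set.inter_subset_right Set.inter_subset_right
  simp only [h, ENNReal.tsum_eq_iSup_sum]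
  exact Measurable.iSup fun t => Finset.measurable_fun_sum t fun l _ =>
    (measurable_count_cellFiltration hA _).mono (le_iSup (fun n => cellFiltration hA n) _) le_rfl

/-- The modified logarithmic Sobolev inequality on Poisson space. -/
theorem IsPoissonLaw.ent_le {X : Type*} [MeasurableSpace X] {Q : Measure (CountingMeasure X)}
    {μ : Measure X} [IsProbabilityMeasure Q] [SigmaFinite μ] (hQ : IsPoissonLaw Q μ)
    {a b : ℝ} (ha : 0 < a) {G : CountingMeasure X → ℝ} (hG : Measurable G)
    (hG' : ∀ ξ, G ξ ∈ Set.Icc a b) :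
    ENNReal.ofReal (ent Q G) ≤
      ∫⁻ ξ, ∫⁻ x, ENNReal.ofReal (psi (G ξ) (G (addPoint ξ x))) ∂μ ∂Q := by
  obtain ⟨A, hA, hμ, hGA⟩ := exists_measurable_iSup_cellFiltration μ hG
  have iG : Integrable G Q := integrable_of_mem_Icc hG hG'
  have hstep : ∀ n, ENNReal.ofReal (ent Q (Q[G | cellFiltration hA n])) ≤
      ∫⁻ ξ, ∫⁻ x, ENNReal.ofReal (psi (G ξ) (G (addPoint ξ x))) ∂μ ∂Q := by
    intro n
    let e := (Fintype.equivFin (CellIndex n)).symm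
    have hσ : countSigma (cells A n) = countSigma fun i => cells A n (e i) := by
      refine le_antisymm (countSigma_le fun s => ?_)
        (countSigma_le fun i => measurable_count_countSigma _ _)
      obtain ⟨i, rfl⟩ := e.surjective s
      exact measurable_count_countSigma (fun i => cells A n (e i)) i
    have hc : (cellFiltration hA n : MeasurableSpace (CountingMeasure X)) =
      countSigma fun i => cells A n (e i) := hσ
    rw [hc]
    refine hQ.ent_condExp_le (fun i => measurableSet_cell hA _ _)
      (fun i j hij => disjoint_cells A n (e.injective.ne hij)) (fun i => ?_) ha hG hG'
    obtain ⟨j, hj⟩ := exists_cells_subset A n (e i)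
    exact ne_top_of_le_ne_top (hμ j) (measure_mono hj)
  have hY : ∀ n, ∀ᵐ ξ ∂Q, (Q[G | cellFiltration hA n]) ξ ∈ Set.Icc a b := by
    intro n
    have h1 := condExp_mono (m := cellFiltration hA n) (integrable_const a) iG
      (Filter.Eventually.of_forall fun ξ => (hG' ξ).1)
    have h2 := condExp_mono (m := cellFiltration hA n) iG (integrable_const b)
      (Filter.Eventually.of_forall fun ξ => (hG' ξ).2)
    rw [condExp_const ((cellFiltration hA).le n)] at h1 h2
    filter_upwards [h1, h2] with ξ h3 h4 using ⟨h3, h4⟩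
  have hYm : ∀ n, Measurable (Q[G | cellFiltration hA n]) := fun n =>
    (stronglyMeasurable_condExp.mono ((cellFiltration hA).le n)).measurable
  -- Lévy's upward theorem; since all conditional expectations lie in [a, b], dominated convergence
  -- carries it over to the entropies.
  have hlim := iG.tendsto_ae_condExp (ℱ := cellFiltration hA) hGA.stronglyMeasurable
  have hl1 : Filter.Tendsto (fun n => ∫ ξ, (Q[G | cellFiltration hA n]) ξ ∂Q) Filter.atTop
      (nhds (∫ ξ, G ξ ∂Q)) := by
    refine tendsto_integral_of_dominated_convergence (fun _ => |b|)
      (fun n => (hYm n).aestronglyMeasurable) (integrable_const _) (fun n => ?_) hlim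
    filter_upwards [hY n] with ξ h
    rw [Real.norm_eq_abs, abs_of_pos (ha.trans_le h.1)]
    exact h.2.trans (le_abs_self b)
  have hl2 : Filter.Tendsto (fun n => ∫ ξ, (Q[G | cellFiltration hA n]) ξ *
      Real.log ((Q[G | cellFiltration hA n]) ξ) ∂Q) Filter.atTop
      (nhds (∫ ξ, G ξ * Real.log (G ξ) ∂Q)) := by
    refine tendsto_integral_of_dominated_convergence
      (fun _ => b * (|Real.log a| + |Real.log b|))
      (fun n => ((hYm n).mul (hYm n).log).aestronglyMeasurable) (integrable_const _)
      (fun n => ?_) ?_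
    · filter_upwards [hY n] with ξ h
      exact abs_le.2 (mul_log_mem_Icc ha h)
    · filter_upwards [hlim] with ξ h
      exact (Real.continuous_mul_log.tendsto _).comp h
  have hl3 : Filter.Tendsto (fun n => ent Q (Q[G | cellFiltration hA n])) Filter.atTop
      (nhds (ent Q G)) :=
    hl2.sub ((Real.continuous_mul_log.tendsto _).comp hl1)
  exact le_of_tendsto' ((ENNReal.continuous_ofReal.tendsto _).comp hl3) hstep

/-! ### The Herbst argument -/

/-- The Herbst argument: an entropy bound for `exp (t f)` bounds the moment generating function. -/
theorem mgf_le_of_ent_le {A : Type*} [MeasurableSpace A] {ν : Measure A} [IsProbabilityMeasure ν]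
    {f : A → ℝ} (hf : Measurable f) {a b : ℝ} (hab : ∀ x, f x ∈ Set.Icc a b) {L : ℝ}
    (hent : ∀ t : ℝ, 0 < t →
      ent ν (fun x => Real.exp (t * f x)) ≤ t ^ 2 * L * ∫ x, Real.exp (t * f x) ∂ν)
    {t : ℝ} (ht : 0 < t) :
    mgf f ν t ≤ Real.exp (t * ∫ x, f x ∂ν + t ^ 2 * L) := by
  have hint : ∀ t : ℝ, Integrable (fun x => Real.exp (t * f x)) ν := fun t =>
    integrable_exp_mul_of_mem_Icc hf.aemeasurable (Filter.Eventually.of_forall hab)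
  have hset : ∀ t, t ∈ interior (integrableExpSet f ν) := by
    have : integrableExpSet f ν = Set.univ := Set.eq_univ_of_forall hint
    simp [this]
  have hdiff : ∀ t, DifferentiableAt ℝ (cgf f ν) t := fun t =>
    (analyticAt_cgf (hset t)).differentiableAt
  have hpos : ∀ t, 0 < mgf f ν t := fun t => mgf_pos (hint t)
  have hder : ∀ s : ℝ, 0 < s → s * deriv (cgf f ν) s - cgf f ν s ≤ s ^ 2 * L := by
    intro s hs
    have h := hent s hs
    unfold ent at h
    have e1 : ∫ x, Real.exp (s * f x) * Real.log (Real.exp (s * f x)) ∂ν =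
        s * ∫ x, f x * Real.exp (s * f x) ∂ν := by
      rw [← integral_const_mul]
      refine integral_congr_ae (Filter.Eventually.of_forall fun x => ?_)
      simp only [Real.log_exp]
      ring
    rw [e1] at h
    change s * _ - mgf f ν s * Real.log (mgf f ν s) ≤ s ^ 2 * L * mgf f ν s at h
    rw [deriv_cgf (hset s)]
    refine le_of_mul_le_mul_right ?_ (hpos s)
    rw [cgf, sub_mul, mul_assoc, div_mul_cancel₀ _ (hpos s).ne']
    linarith
  -- The derivative of `cgf s / s` is `(s cgf' s - cgf s) / s²`, which the entropy bound makes at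
  -- most L. The value at `t` is thus at most the limit at 0, which is the mean.
  have hanti : AntitoneOn (fun s => cgf f ν s / s - L * s) (Set.Ioi 0) := by
    have hd : ∀ s : ℝ, 0 < s → HasDerivAt (fun s => cgf f ν s / s - L * s)
        ((deriv (cgf f ν) s * s - cgf f ν s * 1) / s ^ 2 - L * 1) s := fun s hs =>
      ((hdiff s).hasDerivAt.div (hasDerivAt_id s) hs.ne').sub ((hasDerivAt_id s).const_mul L)
    refine antitoneOn_of_deriv_nonpos (convex_Ioi 0)
      (fun s hs => (hd s hs).continuousAt.continuousWithinAt) (fun s hs => ?_) fun s hs => ?_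
    · rw [interior_Ioi] at hs
      exact (hd s hs).differentiableAt.differentiableWithinAt
    · rw [interior_Ioi] at hs
      have hs0 : 0 < s := hs
      rw [(hd s hs).deriv]
      have : (deriv (cgf f ν) s * s - cgf f ν s * 1) / s ^ 2 ≤ L := by
        rw [div_le_iff₀ (by positivity)]
        linarith [hder s hs0]
      linarith
  have hlim : Filter.Tendsto (fun s => cgf f ν s / s - L * s) (nhdsWithin 0 (Set.Ioi 0))
      (nhds (∫ x, f x ∂ν)) := by
    have h0 : HasDerivAt (cgf f ν) (∫ x, f x ∂ν) 0 := by
      have := (hdiff 0).hasDerivAt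
      rw [deriv_cgf_zero (hset 0)] at this
      simpa using this
    have h1 := h0.tendsto_slope_zero_right
    have h2 : Filter.Tendsto (fun s : ℝ => L * s) (nhdsWithin 0 (Set.Ioi 0)) (nhds (L * 0)) :=
      ((continuous_const_mul L).tendsto 0).mono_left nhdsWithin_le_nhds
    have h3 := h1.sub h2
    simp only [zero_add, cgf_zero, sub_zero, smul_eq_mul, mul_zero] at h3
    refine h3.congr fun s => ?_
    rw [div_eq_inv_mul]
  have hle : cgf f ν t / t - L * t ≤ ∫ x, f x ∂ν := by
    refine ge_of_tendsto hlim ?_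
    filter_upwards [Ioc_mem_nhdsGT ht] with s hs
    exact hanti hs.1 ht hs.2
  rw [← exp_cgf (hint t)]
  refine Real.exp_le_exp.2 ?_
  have h4 : cgf f ν t / t ≤ ∫ x, f x ∂ν + L * t := by linarith
  rw [div_le_iff₀ ht] at h4
  linarith

/-! ### Removal of points -/

theorem removePoint_apply {X : Type*} [MeasurableSpace X] {ξ : CountingMeasure X} {x : X}
    (h : Measure.dirac x ≤ ξ.1) {B : Set X} (hB : MeasurableSet B) :
    (removePoint ξ x).1 B = ξ.1 B - B.indicator 1 x := by
  rw [removePoint, dif_pos h, Measure.sub_apply hB h, Measure.dirac_apply' x hB]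

theorem dirac_le_addPoint {X : Type*} [MeasurableSpace X] (ξ : CountingMeasure X) (x : X) :
    Measure.dirac x ≤ (addPoint ξ x).1 :=
  Measure.le_add_left le_rfl

theorem removePoint_addPoint {X : Type*} [MeasurableSpace X] (ξ : CountingMeasure X) (x : X) :
    removePoint (addPoint ξ x) x = ξ := by
  refine Subtype.ext (Measure.ext fun B hB => ?_)
  rw [removePoint_apply (dirac_le_addPoint ξ x) hB, addPoint_apply _ _ hB]
  by_cases h : x ∈ B <;> simp [h]

theorem addPoint_removePoint {X : Type*} [MeasurableSpace X] {ξ : CountingMeasure X} {x : X}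
    (h : Measure.dirac x ≤ ξ.1) : addPoint (removePoint ξ x) x = ξ := by
  refine Subtype.ext ?_
  rw [addPoint, removePoint, dif_pos h]
  exact Measure.sub_add_cancel_of_le h

/-- A measurable function of `(ξ - δ_x, x)` agrees with a measurable function of `(ξ, x)`, although
the set where `ξ - δ_x` exists need not be measurable. -/
theorem exists_measurable_eq_removePoint {X : Type*} [MeasurableSpace X]
    {k : CountingMeasure X × X → ℝ≥0∞} (hk : Measurable k) :
    ∃ h : CountingMeasure X × X → ℝ≥0∞, Measurable h ∧
      ∀ (ξ : CountingMeasure X) (x : X), Measure.dirac x ≤ ξ.1 →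
        h (ξ, x) = k (removePoint ξ x, x) := by
  let S := {z : CountingMeasure X × X // Measure.dirac z.2 ≤ z.1.1}
  have hR : Measurable fun z : S => (removePoint z.1.1 z.1.2, z.1.2) := by
    refine (measurable_countingMeasure fun B hB => ?_).prodMk
      (measurable_snd.comp measurable_subtype_coe)
    have e : (fun z : S => (removePoint z.1.1 z.1.2).1 B) =
        fun z : S => z.1.1.1 B - B.indicator 1 z.1.2 :=
      funext fun z => removePoint_apply z.2 hB
    rw [e]
    exact ((measurable_count hB).comp (measurable_fst.comp measurable_subtype_coe)).sub
      ((measurable_one.indicator hB).comp (measurable_snd.comp measurable_subtype_coe))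
  -- The subtype carries the σ-field induced by the inclusion, so a measurable function on it
  -- factors through the inclusion even if `S` is not measurable.
  obtain ⟨h, hm, heq⟩ := Measurable.exists_eq_measurable_comp
    (f := (Subtype.val : S → CountingMeasure X × X)) (hk.comp hR)
  exact ⟨h, hm, fun ξ x hx => (congrFun heq ⟨(ξ, x), hx⟩).symm⟩

/-- The terms evaluated at ξ + δ_x are exactly of the form that the Mecke equation turns into an
integral over the points of ξ, so the weight can be taken out. -/
theorem IsPoissonLaw.lintegral_weight {X : Type*} [MeasurableSpace X]
    {Q : Measure (CountingMeasure X)} {μ : Measure X} (hQ : IsPoissonLaw Q μ)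
    [IsProbabilityMeasure Q] [SigmaFinite μ] {w : CountingMeasure X → ℝ≥0∞} (hw : Measurable w)
    {k h : CountingMeasure X × X → ℝ≥0∞} (hk : Measurable k) (hh : Measurable h) :
    ∫⁻ ξ, ∫⁻ x, (w ξ * k (ξ, x) + w (addPoint ξ x) * h (addPoint ξ x, x)) ∂μ ∂Q =
      ∫⁻ ξ, w ξ * (∫⁻ x, k (ξ, x) ∂μ + ∫⁻ x, h (ξ, x) ∂(countKernel μ ξ)) ∂Q := by
  have hmecke := hQ.mecke (h := fun z => w z.1 * h z) ((hw.comp measurable_fst).mul hh)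
  have hwI : Measurable fun ξ => w ξ * ∫⁻ x, k (ξ, x) ∂μ := hw.mul hk.lintegral_prod_right'
  have hkξ : ∀ ξ, Measurable fun x => k (ξ, x) := fun ξ => hk.comp measurable_prodMk_left
  have hhξ : ∀ ξ, Measurable fun x => h (ξ, x) := fun ξ => hh.comp measurable_prodMk_left
  simp only [lintegral_add_left ((hkξ _).const_mul _), mul_add]
  rw [lintegral_add_left hwI, ← lintegral_congr fun ξ => lintegral_const_mul (w ξ) (hhξ ξ), hmecke,
    ← lintegral_add_left hwI]
  exact lintegral_congr fun ξ => by rw [lintegral_const_mul _ (hkξ ξ)]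

/-- Under a bound on `V⁺`, the weighted energy of `f` is bounded by the mean of the weight. -/
theorem IsPoissonProcess.lintegral_weight_le {Ω X : Type*} [MeasurableSpace Ω] [MeasurableSpace X]
    {P : Measure Ω} [IsProbabilityMeasure P] {μ : Measure X} [SigmaFinite μ]
    {η : Ω → CountingMeasure X} (hη : IsPoissonProcess η μ P)
    (hpoints : ∀ᵐ ω ∂P, ∀ᵐ x ∂(η ω).1, Measure.dirac x ≤ (η ω).1)
    {f : CountingMeasure X → ℝ} (hf : Measurable f) {L : ℝ≥0∞}
    (hV : ∀ᵐ ω ∂P, VPlus μ f (η ω) ≤ L)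
    {w : CountingMeasure X → ℝ≥0∞} (hw : Measurable w) :
    ∫⁻ ξ, ∫⁻ x, (w ξ * ENNReal.ofReal ((min 0 (addDiff f ξ x)) ^ 2) +
      w (addPoint ξ x) * ENNReal.ofReal ((max 0 (addDiff f ξ x)) ^ 2)) ∂μ ∂(P.map η) ≤
      L * ∫⁻ ξ, w ξ ∂(P.map η) := by
  have hQ := hη.isPoissonLaw
  have := Measure.isProbabilityMeasure_map (μ := P) hη.measurable.aemeasurable
  have hD : Measurable fun z : CountingMeasure X × X => addDiff f z.1 z.2 :=
    (hf.comp measurable_addPoint).sub (hf.comp measurable_fst)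
  have hmin : Measurable fun z : CountingMeasure X × X =>
      ENNReal.ofReal ((min 0 (addDiff f z.1 z.2)) ^ 2) :=
    ((measurable_const.min hD).pow_const 2).ennreal_ofReal
  have hmax : Measurable fun z : CountingMeasure X × X =>
      ENNReal.ofReal ((max 0 (addDiff f z.1 z.2)) ^ 2) :=
    ((measurable_const.max hD).pow_const 2).ennreal_ofReal
  obtain ⟨h, hm, hh⟩ := exists_measurable_eq_removePoint hmax
  have hadd : ∀ ξ x, ENNReal.ofReal ((max 0 (addDiff f ξ x)) ^ 2) = h (addPoint ξ x, x) := by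
    intro ξ x
    rw [hh _ _ (dirac_le_addPoint ξ x), removePoint_addPoint]
  have hset : MeasurableSet {ξ | ∫⁻ x, ENNReal.ofReal ((min 0 (addDiff f ξ x)) ^ 2) ∂μ +
      ∫⁻ x, h (ξ, x) ∂(countKernel μ ξ) ≤ L} :=
    measurableSet_le (hmin.lintegral_prod_right'.add hm.lintegral_kernel_prod_right')
      measurable_const
  -- The left side is a measurable substitute for V⁺: it agrees with V⁺ almost surely, because
  -- almost every point of η can be removed.
  have hVQ : ∀ᵐ ξ ∂(P.map η), ∫⁻ x, ENNReal.ofReal ((min 0 (addDiff f ξ x)) ^ 2) ∂μ +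
      ∫⁻ x, h (ξ, x) ∂(countKernel μ ξ) ≤ L := by
    rw [ae_map_iff hη.measurable.aemeasurable hset]
    filter_upwards [hV, hpoints, ae_of_ae_map hη.measurable.aemeasurable hQ.countKernel_ae_eq]
      with ω h1 h2 h3
    refine le_of_eq_of_le ?_ h1
    rw [VPlus, h3]
    congr 1
    refine lintegral_congr_ae ?_
    filter_upwards [h2] with x hx
    rw [hh _ _ hx, addDiff, addPoint_removePoint hx, removeDiff]
  simp only [hadd]
  rw [hQ.lintegral_weight hw hmin hm, ← lintegral_const_mul _ hw]
  refine lintegral_mono_ae ?_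
  filter_upwards [hVQ] with ξ hξ
  rw [mul_comm]
  gcongr

/-! ### Concentration -/

/-- From 1 - e^{-z} ≤ z, the increment of the exponential is at most its larger value times z. The
larger endpoint is s' when t ≤ s and t' when s ≤ t, which decides which squared part appears. The
pair (s', t') is a monotone contraction of (s, t), so truncation is allowed. -/
theorem psi_exp_le {s t s' t' l : ℝ} (hl : 0 ≤ l) (h₁ : s ≤ t → s' ≤ t' ∧ t' - s' ≤ t - s)
    (h₂ : t ≤ s → t' ≤ s' ∧ s' - t' ≤ s - t) :
    psi (Real.exp (l * s')) (Real.exp (l * t')) ≤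
      l ^ 2 * (Real.exp (l * s') * (min 0 (t - s)) ^ 2 +
        Real.exp (l * t') * (max 0 (t - s)) ^ 2) := by
  have key : ∀ {u v d : ℝ}, u ≤ v → v - u ≤ d →
      (Real.exp (l * v) - Real.exp (l * u)) * (l * v - l * u) ≤
        l ^ 2 * (Real.exp (l * v) * d ^ 2) := by
    intro u v d huv hd
    have h0 : 0 ≤ l * v - l * u := by nlinarith
    have h1 : Real.exp (l * v) - Real.exp (l * u) ≤ Real.exp (l * v) * (l * v - l * u) := by
      have h := Real.add_one_le_exp (l * u - l * v)
      have h2 : Real.exp (l * u) = Real.exp (l * v) * Real.exp (l * u - l * v) := by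
        rw [← Real.exp_add]; congr 1; ring
      rw [h2]
      nlinarith [Real.exp_pos (l * v)]
    calc _ ≤ Real.exp (l * v) * (l * v - l * u) * (l * v - l * u) :=
          mul_le_mul_of_nonneg_right h1 h0
      _ = l ^ 2 * (Real.exp (l * v) * (v - u) ^ 2) := by ring
      _ ≤ _ := by
          have : (v - u) ^ 2 ≤ d ^ 2 := pow_le_pow_left₀ (by linarith) hd 2
          gcongr
  unfold psi
  rw [Real.log_exp, Real.log_exp]
  rcases le_total s t with h | h
  · obtain ⟨h3, h4⟩ := h₁ h
    rw [min_eq_left (by linarith), max_eq_right (by linarith)]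
    have := key h3 h4
    simpa using this
  · obtain ⟨h3, h4⟩ := h₂ h
    rw [min_eq_right (by linarith), max_eq_left (by linarith)]
    have := key h3 h4
    have e : (t - s) ^ 2 = (s - t) ^ 2 := by ring
    rw [e]
    linarith

theorem clamp_sub_le {M s t : ℝ} (h : s ≤ t) :
    max (-M) (min M s) ≤ max (-M) (min M t) ∧
      max (-M) (min M t) - max (-M) (min M s) ≤ t - s := by
  refine ⟨max_le_max_left _ (min_le_min_left _ h), ?_⟩
  have h1 : min M t ≤ min M s + (t - s) := by
    rcases min_cases M s with ⟨h2, _⟩ | ⟨h2, _⟩ <;> rw [h2]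
    · linarith [min_le_left M t]
    · linarith [min_le_right M t]
  have h2 : max (-M) (min M t) ≤ max (-M) (min M s) + (t - s) :=
    max_le (by linarith [le_max_left (-M) (min M s)])
      (by linarith [le_max_right (-M) (min M s)])
  linarith

/-- The Sobolev inequality needs a function bounded away from 0 and ∞, whence the truncation. The
energy is still measured by the increments of the untruncated `f`, so the bound depends on M only
through the mean. -/
theorem IsPoissonProcess.mgf_clamp_le {Ω X : Type*} [MeasurableSpace Ω] [MeasurableSpace X]
    {P : Measure Ω} [IsProbabilityMeasure P] {μ : Measure X} [SigmaFinite μ]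
    {η : Ω → CountingMeasure X} (hη : IsPoissonProcess η μ P)
    (hpoints : ∀ᵐ ω ∂P, ∀ᵐ x ∂(η ω).1, Measure.dirac x ≤ (η ω).1)
    {f : CountingMeasure X → ℝ} (hf : Measurable f) {L : ℝ} (hL : 0 ≤ L)
    (hV : ∀ᵐ ω ∂P, VPlus μ f (η ω) ≤ ENNReal.ofReal L) {M : ℝ} (hM : 0 ≤ M) {t : ℝ}
    (ht : 0 < t) :
    mgf (fun ξ => max (-M) (min M (f ξ))) (P.map η) t ≤
      Real.exp (t * ∫ ξ, max (-M) (min M (f ξ)) ∂(P.map η) + t ^ 2 * L) := by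
  have hQ := hη.isPoissonLaw
  have := Measure.isProbabilityMeasure_map (μ := P) hη.measurable.aemeasurable
  set φ : CountingMeasure X → ℝ := fun ξ => max (-M) (min M (f ξ)) with hφd
  have hφ : Measurable φ := measurable_const.max (measurable_const.min hf)
  have hφM : ∀ ξ, φ ξ ∈ Set.Icc (-M) M := fun ξ =>
    ⟨le_max_left _ _, max_le (by linarith) (min_le_left _ _)⟩
  refine mgf_le_of_ent_le hφ hφM (fun l hl => ?_) ht
  have hG : Measurable fun ξ => Real.exp (l * φ ξ) := (hφ.const_mul l).exp
  have hG' : ∀ ξ, Real.exp (l * φ ξ) ∈ Set.Icc (Real.exp (l * -M)) (Real.exp (l * M)) :=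
    fun ξ => ⟨Real.exp_le_exp.2 (mul_le_mul_of_nonneg_left (hφM ξ).1 hl.le),
      Real.exp_le_exp.2 (mul_le_mul_of_nonneg_left (hφM ξ).2 hl.le)⟩
  have hiG : Integrable (fun ξ => Real.exp (l * φ ξ)) (P.map η) := integrable_of_mem_Icc hG hG'
  have h1 := hQ.ent_le (Real.exp_pos _) hG hG'
  have h2 := hη.lintegral_weight_le hpoints hf hV hG.ennreal_ofReal
  have h3 : ∫⁻ ξ, ∫⁻ x, ENNReal.ofReal (psi (Real.exp (l * φ ξ))
        (Real.exp (l * φ (addPoint ξ x)))) ∂μ ∂(P.map η) ≤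
      ENNReal.ofReal (l ^ 2) * ∫⁻ ξ, ∫⁻ x, (ENNReal.ofReal (Real.exp (l * φ ξ)) *
        ENNReal.ofReal ((min 0 (addDiff f ξ x)) ^ 2) +
        ENNReal.ofReal (Real.exp (l * φ (addPoint ξ x))) *
          ENNReal.ofReal ((max 0 (addDiff f ξ x)) ^ 2)) ∂μ ∂(P.map η) := by
    rw [← lintegral_const_mul' _ _ ENNReal.ofReal_ne_top]
    refine lintegral_mono fun ξ => ?_
    rw [← lintegral_const_mul' _ _ ENNReal.ofReal_ne_top]
    refine lintegral_mono fun x => ?_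
    rw [← ENNReal.ofReal_mul (Real.exp_pos _).le, ← ENNReal.ofReal_mul (Real.exp_pos _).le,
      ← ENNReal.ofReal_add (by positivity) (by positivity), ← ENNReal.ofReal_mul (by positivity)]
    exact ENNReal.ofReal_le_ofReal (psi_exp_le hl.le clamp_sub_le clamp_sub_le)
  have h4 := h1.trans (h3.trans (mul_le_mul_right h2 (ENNReal.ofReal (l ^ 2))))
  rw [← ofReal_integral_eq_lintegral_ofReal hiG
    (Filter.Eventually.of_forall fun _ => (Real.exp_pos _).le), ← ENNReal.ofReal_mul hL,
    ← ENNReal.ofReal_mul (by positivity)] at h4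
  have hnn : 0 ≤ ∫ ξ, Real.exp (l * φ ξ) ∂(P.map η) := integral_nonneg fun _ => (Real.exp_pos _).le
  have h5 := (ENNReal.ofReal_le_ofReal_iff (by positivity)).1 h4
  linarith

/-- Fatou's lemma as the truncation level grows, the means converging by integrability of `f`. The
lower integral avoids presupposing that the exponential is integrable. -/
theorem IsPoissonProcess.lintegral_exp_le {Ω X : Type*} [MeasurableSpace Ω] [MeasurableSpace X]
    {P : Measure Ω} [IsProbabilityMeasure P] {μ : Measure X} [SigmaFinite μ]
    {η : Ω → CountingMeasure X} (hη : IsPoissonProcess η μ P)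
    (hpoints : ∀ᵐ ω ∂P, ∀ᵐ x ∂(η ω).1, Measure.dirac x ≤ (η ω).1)
    {f : CountingMeasure X → ℝ} (hf : Measurable f) (hfi : Integrable f (P.map η)) {L : ℝ}
    (hL : 0 ≤ L) (hV : ∀ᵐ ω ∂P, VPlus μ f (η ω) ≤ ENNReal.ofReal L) {t : ℝ} (ht : 0 < t) :
    ∫⁻ ξ, ENNReal.ofReal (Real.exp (t * (f ξ - ∫ ξ', f ξ' ∂(P.map η)))) ∂(P.map η) ≤
      ENNReal.ofReal (Real.exp (t ^ 2 * L)) := by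
  have := Measure.isProbabilityMeasure_map (μ := P) hη.measurable.aemeasurable
  let φ : ℕ → CountingMeasure X → ℝ := fun n ξ => max (-(n : ℝ)) (min n (f ξ))
  have hφ : ∀ n, Measurable (φ n) := fun n => measurable_const.max (measurable_const.min hf)
  have hφM : ∀ (n : ℕ) ξ, φ n ξ ∈ Set.Icc (-(n : ℝ)) n := fun n ξ =>
    ⟨le_max_left _ _, max_le (by linarith [n.cast_nonneg (α := ℝ)]) (min_le_left _ _)⟩
  have hφf : ∀ ξ, Filter.Tendsto (fun n => φ n ξ) Filter.atTop (nhds (f ξ)) := by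
    intro ξ
    obtain ⟨N, hN⟩ := exists_nat_ge |f ξ|
    refine tendsto_const_nhds.congr' ?_
    filter_upwards [Filter.eventually_ge_atTop N] with n hn
    have hn' : |f ξ| ≤ n := hN.trans (by exact_mod_cast hn)
    obtain ⟨h1, h2⟩ := abs_le.1 hn'
    simp only [φ, min_eq_right h2, max_eq_right h1]
  have hE : Filter.Tendsto (fun n => ∫ ξ, φ n ξ ∂(P.map η)) Filter.atTop
      (nhds (∫ ξ, f ξ ∂(P.map η))) := by
    refine tendsto_integral_of_dominated_convergence (fun ξ => |f ξ|)
      (fun n => (hφ n).aestronglyMeasurable) hfi.abs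
      (fun n => Filter.Eventually.of_forall fun ξ => ?_) (Filter.Eventually.of_forall hφf)
    have hn : (0 : ℝ) ≤ n := n.cast_nonneg
    refine abs_le.2 ⟨?_, ?_⟩
    · exact le_max_of_le_right (le_min (by linarith [abs_nonneg (f ξ)]) (neg_abs_le _))
    · exact max_le (by linarith [abs_nonneg (f ξ)]) ((min_le_right _ _).trans (le_abs_self _))
  have hbound : ∀ n, ∫⁻ ξ, ENNReal.ofReal
      (Real.exp (t * (φ n ξ - ∫ ξ', φ n ξ' ∂(P.map η)))) ∂(P.map η) ≤
      ENNReal.ofReal (Real.exp (t ^ 2 * L)) := by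
    intro n
    have h := hη.mgf_clamp_le hpoints hf hL hV (M := n) n.cast_nonneg ht
    change mgf (φ n) (P.map η) t ≤ Real.exp (t * ∫ ξ, φ n ξ ∂(P.map η) + t ^ 2 * L) at h
    have hi : Integrable (fun ξ => Real.exp (t * φ n ξ)) (P.map η) :=
      integrable_exp_mul_of_mem_Icc (hφ n).aemeasurable (Filter.Eventually.of_forall (hφM n))
    have e : ∀ ξ, Real.exp (t * (φ n ξ - ∫ ξ', φ n ξ' ∂(P.map η))) =
        Real.exp (-(t * ∫ ξ', φ n ξ' ∂(P.map η))) * Real.exp (t * φ n ξ) := fun ξ => by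
      rw [← Real.exp_add]; congr 1; ring
    simp only [e]
    rw [← ofReal_integral_eq_lintegral_ofReal (hi.const_mul _)
      (Filter.Eventually.of_forall fun _ => by positivity), integral_const_mul]
    refine ENNReal.ofReal_le_ofReal ?_
    refine (mul_le_mul_of_nonneg_left h (Real.exp_pos _).le).trans (le_of_eq ?_)
    rw [← Real.exp_add]
    congr 1
    ring
  calc _ = ∫⁻ ξ, Filter.liminf (fun n => ENNReal.ofReal
        (Real.exp (t * (φ n ξ - ∫ ξ', φ n ξ' ∂(P.map η))))) Filter.atTop ∂(P.map η) := by
        refine lintegral_congr fun ξ => (Filter.Tendsto.liminf_eq ?_).symm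
        exact ENNReal.tendsto_ofReal ((Real.continuous_exp.tendsto _).comp
          (((hφf ξ).sub hE).const_mul t))
    _ ≤ Filter.liminf (fun n => ∫⁻ ξ, ENNReal.ofReal
        (Real.exp (t * (φ n ξ - ∫ ξ', φ n ξ' ∂(P.map η)))) ∂(P.map η)) Filter.atTop :=
        lintegral_liminf_le fun n => (((hφ n).sub_const _).const_mul t).exp.ennreal_ofReal
    _ ≤ _ := Filter.liminf_le_of_le (by isBoundedDefault) fun c hc => by
        obtain ⟨n, hn⟩ := hc.exists
        exact hn.trans (hbound n)

/-- The upper tail bound under a bound on `V⁺`. -/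
theorem IsPoissonProcess.measureReal_ge_le {Ω X : Type*} [MeasurableSpace Ω] [MeasurableSpace X]
    {P : Measure Ω} [IsProbabilityMeasure P] {μ : Measure X} [SigmaFinite μ]
    {η : Ω → CountingMeasure X} (hη : IsPoissonProcess η μ P)
    (hpoints : ∀ᵐ ω ∂P, ∀ᵐ x ∂(η ω).1, Measure.dirac x ≤ (η ω).1)
    {f : CountingMeasure X → ℝ} (hf : Measurable f) {F : Ω → ℝ}
    (hF : F =ᵐ[P] fun ω => f (η ω)) (hFi : Integrable F P) {L : ℝ}
    (hL : 0 < L) (hV : ∀ᵐ ω ∂P, VPlus μ f (η ω) ≤ ENNReal.ofReal L) {t : ℝ} (ht : 0 ≤ t) :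
    P.real {ω | t ≤ F ω - ∫ ω', F ω' ∂P} ≤ Real.exp (-(t ^ 2 / (4 * L))) := by
  rcases ht.eq_or_lt with rfl | ht
  · simp [measureReal_le_one]
  have hfi : Integrable f (P.map η) :=
    (integrable_map_measure hf.aestronglyMeasurable hη.measurable.aemeasurable).2 (hFi.congr hF)
  have hE : ∫ ξ, f ξ ∂(P.map η) = ∫ ω, F ω ∂P := by
    rw [integral_map hη.measurable.aemeasurable hf.aestronglyMeasurable]
    exact (integral_congr_ae hF).symm
  -- The minimiser of s² L - s t, with minimum -t² / (4 L).
  set s := t / (2 * L)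
  have hs : 0 < s := by positivity
  have h1 := hη.lintegral_exp_le hpoints hf hfi hL.le hV hs
  have hm : Measurable fun ξ => ENNReal.ofReal (Real.exp (s * (f ξ - ∫ ξ', f ξ' ∂(P.map η)))) :=
    ((hf.sub_const _).const_mul s).exp.ennreal_ofReal
  rw [lintegral_map hm hη.measurable, hE] at h1
  have h2 := (mul_meas_ge_le_lintegral₀ (μ := P) ((hm.comp hη.measurable).aemeasurable)
    (ENNReal.ofReal (Real.exp (s * t))))
  simp only [Function.comp_def, hE] at h2
  have h3 : P {ω | t ≤ F ω - ∫ ω', F ω' ∂P} ≤ P {ω | ENNReal.ofReal (Real.exp (s * t)) ≤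
      ENNReal.ofReal (Real.exp (s * (f (η ω) - ∫ ω', F ω' ∂P)))} := by
    refine measure_mono_ae ?_
    filter_upwards [hF] with ω hω h
    have h' : t ≤ F ω - ∫ ω', F ω' ∂P := h
    rw [hω] at h'
    exact ENNReal.ofReal_le_ofReal (Real.exp_le_exp.2 (mul_le_mul_of_nonneg_left h' hs.le))
  have h4 : ENNReal.ofReal (Real.exp (s * t)) * P {ω | t ≤ F ω - ∫ ω', F ω' ∂P} ≤
      ENNReal.ofReal (Real.exp (s ^ 2 * L)) :=
    ((mul_le_mul_right h3 _).trans h2).trans h1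
  rw [← ofReal_measureReal, ← ENNReal.ofReal_mul (Real.exp_pos _).le,
    ENNReal.ofReal_le_ofReal_iff (Real.exp_pos _).le] at h4
  have h5 : Real.exp (s ^ 2 * L) = Real.exp (s * t) * Real.exp (-(t ^ 2 / (4 * L))) := by
    rw [← Real.exp_add]
    congr 1
    simp only [s]
    field_simp
    ring
  rw [h5] at h4
  exact le_of_mul_le_mul_left h4 (Real.exp_pos _)

/-- A change of sign swaps positive and negative parts, so the lower tail of F is the upper tail of
-F. -/
theorem VPlus_neg {X : Type*} [MeasurableSpace X] (μ : Measure X) (f : CountingMeasure X → ℝ)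
    (ξ : CountingMeasure X) : VPlus μ (fun ξ => -f ξ) ξ = VMinus μ f ξ := by
  have h1 : ∀ a b : ℝ, (min 0 (-a - -b)) ^ 2 = (max 0 (a - b)) ^ 2 := fun a b => by
    rcases le_total a b with h | h
    · rw [min_eq_left (by linarith), max_eq_left (by linarith)]
    · rw [min_eq_right (by linarith), max_eq_right (by linarith)]
      ring
  have h2 : ∀ a b : ℝ, (max 0 (-a - -b)) ^ 2 = (min 0 (a - b)) ^ 2 := fun a b => by
    rw [← h1, neg_neg, neg_neg]
  simp only [VPlus, VMinus, addDiff, removeDiff, h1, h2]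

theorem sq_min_zero_le (a : ℝ) : (min 0 a) ^ 2 ≤ a ^ 2 := by
  rcases le_total 0 a with h | h <;> simp [h, sq_nonneg a]

theorem sq_max_zero_le (a : ℝ) : (max 0 a) ^ 2 ≤ a ^ 2 := by
  rcases le_total 0 a with h | h <;> simp [h, sq_nonneg a]

theorem VPlus_le_VTotal {X : Type*} [MeasurableSpace X] (μ : Measure X)
    (f : CountingMeasure X → ℝ) (ξ : CountingMeasure X) : VPlus μ f ξ ≤ VTotal μ f ξ :=
  add_le_add (lintegral_mono fun _ => ENNReal.ofReal_le_ofReal (sq_min_zero_le _))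
    (lintegral_mono fun _ => ENNReal.ofReal_le_ofReal (sq_max_zero_le _))

theorem VMinus_le_VTotal {X : Type*} [MeasurableSpace X] (μ : Measure X)
    (f : CountingMeasure X → ℝ) (ξ : CountingMeasure X) : VMinus μ f ξ ≤ VTotal μ f ξ :=
  add_le_add (lintegral_mono fun _ => ENNReal.ofReal_le_ofReal (sq_max_zero_le _))
    (lintegral_mono fun _ => ENNReal.ofReal_le_ofReal (sq_min_zero_le _))

theorem half_le_kappa : 1 / 2 ≤ kappa := by
  have h : 1 < √(Real.exp 1) := by
    rw [Real.lt_sqrt zero_le_one]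
    simp
  rw [kappa, div_le_div_iff₀ two_pos (by linarith)]
  linarith

/-- With log 2 ≤ 1, κ ≥ 1/2 and d ≥ 8, the quotient is at most 1 / (8 · 1/2). The cases d = 8 and d
= 16 are the ones needed. -/
theorem log_two_div_kappa_le {d : ℝ} (hd : 8 ≤ d) : Real.log 2 / (d * kappa) ≤ 1 / 4 := by
  have h := half_le_kappa
  have h2 : Real.log 2 ≤ 1 := by linarith [Real.log_two_lt_d9]
  rw [div_le_div_iff₀ (by positivity) (by norm_num)]
  nlinarith

theorem exp_neg_sq_div_le {c L : ℝ} (hc : c ≤ 1 / 4) (hL : 0 < L) (t : ℝ) :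
    Real.exp (-(t ^ 2 / (4 * L))) ≤ Real.exp (-c * t ^ 2 / L) := by
  refine Real.exp_le_exp.2 ?_
  have h : c * (t ^ 2 / L) ≤ 1 / 4 * (t ^ 2 / L) := mul_le_mul_of_nonneg_right hc (by positivity)
  have e1 : -c * t ^ 2 / L = -(c * (t ^ 2 / L)) := by ring
  have e2 : t ^ 2 / (4 * L) = 1 / 4 * (t ^ 2 / L) := by field_simp
  rw [e1, e2]
  linarith

/-- The lower tail bound under a bound on `V⁻`. -/
theorem IsPoissonProcess.measureReal_le_neg_le {Ω X : Type*} [MeasurableSpace Ω]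
    [MeasurableSpace X] {P : Measure Ω} [IsProbabilityMeasure P] {μ : Measure X} [SigmaFinite μ]
    {η : Ω → CountingMeasure X} (hη : IsPoissonProcess η μ P)
    (hpoints : ∀ᵐ ω ∂P, ∀ᵐ x ∂(η ω).1, Measure.dirac x ≤ (η ω).1)
    {f : CountingMeasure X → ℝ} (hf : Measurable f) {F : Ω → ℝ}
    (hF : F =ᵐ[P] fun ω => f (η ω)) (hFi : Integrable F P) {L : ℝ}
    (hL : 0 < L) (hV : ∀ᵐ ω ∂P, VMinus μ f (η ω) ≤ ENNReal.ofReal L) {t : ℝ} (ht : 0 ≤ t) :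
    P.real {ω | F ω - ∫ ω', F ω' ∂P ≤ -t} ≤ Real.exp (-(t ^ 2 / (4 * L))) := by
  have h := hη.measureReal_ge_le hpoints hf.neg (F := fun ω => -F ω)
    (hF.mono fun ω hω => by simp [hω]) hFi.neg hL
    (hV.mono fun ω hω => by
      have := VPlus_neg μ f (η ω)
      exact this.trans_le hω) ht
  rw [integral_neg] at h
  refine le_of_eq_of_le (congrArg P.real (Set.ext fun ω => ?_)) h
  simp only [Set.mem_ofPred_eq]
  constructor <;> intro h <;> linarith

end PoissonConcentration

end

theorem corollary4p3 {Ω X : Type*} [MeasurableSpace Ω] [MeasurableSpace X]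
    (P : Measure Ω) [IsProbabilityMeasure P] (μ : Measure X) [SigmaFinite μ]
    (η : Ω → PoissonConcentration.CountingMeasure X)
    (hη : PoissonConcentration.IsPoissonProcess η μ P)
    -- almost surely `η - δ_x` is a counting measure for `η`-almost every `x`,
    -- so that the integrands in `V⁺`, `V⁻`, `V` are defined
    (hpoints : ∀ᵐ ω ∂P, ∀ᵐ x ∂(η ω).1, Measure.dirac x ≤ (η ω).1)
    (f : PoissonConcentration.CountingMeasure X → ℝ) (hf : Measurable f)
    (F : Ω → ℝ) (hF : F =ᵐ[P] fun ω => f (η ω)) (hF_int : Integrable F P) :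
    (∀ L : ℝ, 0 < L →
      (∀ᵐ ω ∂P, PoissonConcentration.VPlus μ f (η ω) ≤ ENNReal.ofReal L) →
      ∀ t : ℝ, 4 * √PoissonConcentration.kappa ≤ t →
        P.real {ω | t ≤ F ω - ∫ ω', F ω' ∂P} ≤
          Real.exp (-(Real.log 2 / (8 * PoissonConcentration.kappa)) * t ^ 2 / L)) ∧
    (∀ L : ℝ, 0 < L →
      (∀ᵐ ω ∂P, PoissonConcentration.VMinus μ f (η ω) ≤ ENNReal.ofReal L) →
      ∀ t : ℝ, 4 * √PoissonConcentration.kappa ≤ t →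
        P.real {ω | F ω - ∫ ω', F ω' ∂P ≤ -t} ≤
          Real.exp (-(Real.log 2 / (8 * PoissonConcentration.kappa)) * t ^ 2 / L)) ∧
    (∀ L : ℝ, 0 < L →
      (∀ᵐ ω ∂P, PoissonConcentration.VTotal μ f (η ω) ≤ ENNReal.ofReal L) →
      ∀ t : ℝ, 0 ≤ t →
        P.real {ω | t ≤ |F ω - ∫ ω', F ω' ∂P|} ≤
          2 * Real.exp (-(Real.log 2 / (16 * PoissonConcentration.kappa)) * t ^ 2 / L)) := by
  refine ⟨fun L hL hV t ht => ?_, fun L hL hV t ht => ?_, fun L hL hV t ht => ?_⟩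
  · have ht0 : 0 ≤ t := le_trans (by positivity) ht
    exact (hη.measureReal_ge_le hpoints hf hF hF_int hL hV ht0).trans
      (PoissonConcentration.exp_neg_sq_div_le
        (PoissonConcentration.log_two_div_kappa_le le_rfl) hL t)
  · have ht0 : 0 ≤ t := le_trans (by positivity) ht
    exact (hη.measureReal_le_neg_le hpoints hf hF hF_int hL hV ht0).trans
      (PoissonConcentration.exp_neg_sq_div_le
        (PoissonConcentration.log_two_div_kappa_le le_rfl) hL t)
  · have h1 := hη.measureReal_ge_le hpoints hf hF hF_int hL
      (hV.mono fun ω h => (PoissonConcentration.VPlus_le_VTotal μ f (η ω)).trans h) ht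
    have h2 := hη.measureReal_le_neg_le hpoints hf hF hF_int hL
      (hV.mono fun ω h => (PoissonConcentration.VMinus_le_VTotal μ f (η ω)).trans h) ht
    have h3 := PoissonConcentration.exp_neg_sq_div_le
      (PoissonConcentration.log_two_div_kappa_le (d := 16) (by norm_num)) hL t
    have h4 : {ω | t ≤ |F ω - ∫ ω', F ω' ∂P|} ⊆
        {ω | t ≤ F ω - ∫ ω', F ω' ∂P} ∪ {ω | F ω - ∫ ω', F ω' ∂P ≤ -t} := by
      intro ω h
      rcases le_abs.1 (show t ≤ |F ω - ∫ ω', F ω' ∂P| from h) with h' | h'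
      · exact Or.inl h'
      · exact Or.inr (le_neg_of_le_neg h')
    linarith [(measureReal_mono h4).trans
      (measureReal_union_le (μ := P) {ω | t ≤ F ω - ∫ ω', F ω' ∂P} _)]
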